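/- Let $N,k$ be integers with $2\le k<N/2$ and let $\Omega\subset\mathbb R^N$ be a bounded open set (for instance, a bounded domain with smooth boundary). Put $$p^*:=\frac{N(k+1)}{k(N+2)}.$$ For $u\in W^{2,kp^*}(\Omega)$ (real-valued) let $S_k[u]$ be the $k$-Hessian of $u$, that is, $$S_k[u](x)=\sigma_k(\Lambda_1(x),\dots,\Lambda_N(x))=\sum_{1\le i_1<\dots<i_k\le N}\Lambda_{i_1}(x)\cdots\Lambda_{i_k}(x)\quad\text{for a.e. }x\in\Omega,$$ where $\Lambda_1(x),\dots,\Lambda_N(x)$ are the eigenvalues, counted with multiplicity, of the matrix $D^2u(x)$ of weak second derivatives of $u$. Then $S_k[u]\in L^{p^*}(\Omega)$ for every $u\in W^{2,kp^*}(\Omega)$, and $S_k$ is sequentially weakly continuous: if $u_n\rightharpoonup u$ weakly in $W^{2,kp^*}(\Omega)$, then $S_k[u_n]\rightharpoonup S_k[u]$ weakly in $L^{p^*}(\Omega)$. -/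

import Mathlib

open MeasureTheory Filter Topology
open scoped ENNReal ContDiff

noncomputable section

/-- The exponent `p* = N (k + 1) / (k (N + 2))`. -/
def pStar (N k : ℕ) : ℝ≥0∞ :=
  ENNReal.ofReal (((N : ℝ) * ((k : ℝ) + 1)) / ((k : ℝ) * ((N : ℝ) + 2)))

theorem one_le_pStar {N k : ℕ} (hk : 2 ≤ k) (hkN : 2 * k < N) : 1 ≤ pStar N k := by
  have h1 : (2 : ℝ) ≤ k := by exact_mod_cast hk
  have h2 : 2 * (k : ℝ) < N := by exact_mod_cast hkN
  rw [pStar, ENNReal.one_le_ofReal, one_le_div (by positivity)]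
  nlinarith

theorem one_le_mul_pStar {N k : ℕ} (hk : 2 ≤ k) (hkN : 2 * k < N) :
    1 ≤ (k : ℝ≥0∞) * pStar N k := by
  have h1 : (1 : ℝ≥0∞) ≤ k := by exact_mod_cast (by omega : 1 ≤ k)
  exact one_le_mul h1 (one_le_pStar hk hkN)

/-- `g` is the weak partial derivative of `f` in the `i`-th coordinate direction on `Ω`
(for functions `f`, `g` that are locally integrable on `Ω`). -/
def IsWeakPartial {N : ℕ} (Ω : Set (EuclideanSpace ℝ (Fin N))) (i : Fin N)
    (f g : EuclideanSpace ℝ (Fin N) → ℝ) : Prop :=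
  ∀ φ : EuclideanSpace ℝ (Fin N) → ℝ,
    ContDiff ℝ ∞ φ → HasCompactSupport φ → tsupport φ ⊆ Ω →
      ∫ x in Ω, f x * fderiv ℝ φ x (EuclideanSpace.single i 1) = -∫ x in Ω, g x * φ x

/-- Elements of `L^p` times continuous compactly supported functions are integrable. -/
theorem integrable_Lp_mul_of_hasCompactSupport {N : ℕ} (Ω : Set (EuclideanSpace ℝ (Fin N)))
    {p : ℝ≥0∞} [Fact (1 ≤ p)] (f : Lp ℝ p (volume.restrict Ω))
    {φ : EuclideanSpace ℝ (Fin N) → ℝ} (hφ : Continuous φ) (hc : HasCompactSupport φ) :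
    Integrable (fun x => f x * φ x) (volume.restrict Ω) := by
  have hf : LocallyIntegrable (f : EuclideanSpace ℝ (Fin N) → ℝ) (volume.restrict Ω) :=
    (Lp.memLp f).locallyIntegrable Fact.out
  simpa [mul_comm] using hf.integrable_smul_left_of_hasCompactSupport hφ hc

theorem integrable_Lp_mul_fderiv {N : ℕ} (Ω : Set (EuclideanSpace ℝ (Fin N)))
    {p : ℝ≥0∞} [Fact (1 ≤ p)] (f : Lp ℝ p (volume.restrict Ω)) (i : Fin N)
    {φ : EuclideanSpace ℝ (Fin N) → ℝ} (hφ : ContDiff ℝ ∞ φ) (hc : HasCompactSupport φ) :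
    Integrable (fun x => f x * fderiv ℝ φ x (EuclideanSpace.single i 1)) (volume.restrict Ω) :=
  integrable_Lp_mul_of_hasCompactSupport Ω f
    ((hφ.continuous_fderiv (by simp)).clm_apply continuous_const)
    (hc.fderiv_apply (𝕜 := ℝ) (EuclideanSpace.single i 1))

theorem IsWeakPartial.zero {N : ℕ} (Ω : Set (EuclideanSpace ℝ (Fin N)))
    {p : ℝ≥0∞} (i : Fin N) :
    IsWeakPartial Ω i (0 : Lp ℝ p (volume.restrict Ω)) (0 : Lp ℝ p (volume.restrict Ω)) := by
  intro φ _ _ _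
  have h := Lp.coeFn_zero ℝ p (volume.restrict Ω)
  rw [integral_eq_zero_of_ae, integral_eq_zero_of_ae, neg_zero] <;>
  · filter_upwards [h] with x hx
    rw [hx, Pi.zero_apply, zero_mul]

theorem IsWeakPartial.add {N : ℕ} {Ω : Set (EuclideanSpace ℝ (Fin N))}
    {p : ℝ≥0∞} [Fact (1 ≤ p)] {i : Fin N} {f g f' g' : Lp ℝ p (volume.restrict Ω)}
    (h : IsWeakPartial Ω i f g) (h' : IsWeakPartial Ω i f' g') :
    IsWeakPartial Ω i (f + f' : Lp ℝ p (volume.restrict Ω))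
      (g + g' : Lp ℝ p (volume.restrict Ω)) := by
  intro φ hφ hc hs
  have e1 : ∫ x in Ω, (f + f' : Lp ℝ p (volume.restrict Ω)) x
        * fderiv ℝ φ x (EuclideanSpace.single i 1)
      = ∫ x in Ω, (f x * fderiv ℝ φ x (EuclideanSpace.single i 1)
        + f' x * fderiv ℝ φ x (EuclideanSpace.single i 1)) := by
    refine integral_congr_ae ?_
    filter_upwards [Lp.coeFn_add f f'] with x hx
    rw [hx, Pi.add_apply, add_mul]
  have e2 : ∫ x in Ω, (g + g' : Lp ℝ p (volume.restrict Ω)) x * φ x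
      = ∫ x in Ω, (g x * φ x + g' x * φ x) := by
    refine integral_congr_ae ?_
    filter_upwards [Lp.coeFn_add g g'] with x hx
    rw [hx, Pi.add_apply, add_mul]
  rw [e1, e2, integral_add (integrable_Lp_mul_fderiv Ω f i hφ hc)
    (integrable_Lp_mul_fderiv Ω f' i hφ hc),
    integral_add (integrable_Lp_mul_of_hasCompactSupport Ω g hφ.continuous hc)
    (integrable_Lp_mul_of_hasCompactSupport Ω g' hφ.continuous hc),
    h φ hφ hc hs, h' φ hφ hc hs]
  ring

theorem IsWeakPartial.smul {N : ℕ} {Ω : Set (EuclideanSpace ℝ (Fin N))}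
    {p : ℝ≥0∞} {i : Fin N} {f g : Lp ℝ p (volume.restrict Ω)}
    (c : ℝ) (h : IsWeakPartial Ω i f g) :
    IsWeakPartial Ω i (c • f : Lp ℝ p (volume.restrict Ω))
      (c • g : Lp ℝ p (volume.restrict Ω)) := by
  intro φ hφ hc hs
  have e1 : ∫ x in Ω, (c • f : Lp ℝ p (volume.restrict Ω)) x
        * fderiv ℝ φ x (EuclideanSpace.single i 1)
      = ∫ x in Ω, c * (f x * fderiv ℝ φ x (EuclideanSpace.single i 1)) := by
    refine integral_congr_ae ?_
    filter_upwards [Lp.coeFn_smul c f] with x hx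
    rw [hx, Pi.smul_apply, smul_eq_mul, mul_assoc]
  have e2 : ∫ x in Ω, (c • g : Lp ℝ p (volume.restrict Ω)) x * φ x
      = ∫ x in Ω, c * (g x * φ x) := by
    refine integral_congr_ae ?_
    filter_upwards [Lp.coeFn_smul c g] with x hx
    rw [hx, Pi.smul_apply, smul_eq_mul, mul_assoc]
  rw [e1, e2, integral_const_mul, integral_const_mul, h φ hφ hc hs]
  ring

/-- The real Sobolev space `W^{2,p}(Ω)`. A function `u ∈ L^p(Ω)` whose weak partial derivatives
of orders one and two exist and belong to `L^p(Ω)` is stored together with these derivatives, as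
the triple `(u, (∂ᵢu)ᵢ, (∂ⱼ∂ᵢu)ᵢⱼ)`; on an open set the derivatives are determined by `u`. The norm
inherited from the product is the maximum of the `L^p` norms of all these functions, which is
equivalent to the usual Sobolev norm. -/
def SobolevW2 {N : ℕ} (Ω : Set (EuclideanSpace ℝ (Fin N))) (p : ℝ≥0∞) [Fact (1 ≤ p)] :
    Submodule ℝ (Lp ℝ p (volume.restrict Ω) × (Fin N → Lp ℝ p (volume.restrict Ω)) ×
      (Fin N → Fin N → Lp ℝ p (volume.restrict Ω))) where
  carrier := {w | (∀ i, IsWeakPartial Ω i w.1 (w.2.1 i)) ∧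
    ∀ i j, IsWeakPartial Ω j (w.2.1 i) (w.2.2 i j)}
  zero_mem' := ⟨fun i => IsWeakPartial.zero Ω i, fun _ j => IsWeakPartial.zero Ω j⟩
  add_mem' := fun ha hb => ⟨fun i => (ha.1 i).add (hb.1 i), fun i j => (ha.2 i j).add (hb.2 i j)⟩
  smul_mem' := fun c _ ha => ⟨fun i => (ha.1 i).smul c, fun i j => (ha.2 i j).smul c⟩

/-- The Hessian matrix `D²u(x)` of weak second derivatives of `u ∈ W^{2,p}(Ω)` (defined for almost
every `x ∈ Ω`, through representatives). -/
def SobolevW2.hessian {N : ℕ} {Ω : Set (EuclideanSpace ℝ (Fin N))} {p : ℝ≥0∞} [Fact (1 ≤ p)]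
    (u : SobolevW2 Ω p) (x : EuclideanSpace ℝ (Fin N)) : Matrix (Fin N) (Fin N) ℝ :=
  Matrix.of fun i j => u.1.2.2 i j x

/-- The `k`-th elementary symmetric polynomial of the eigenvalues of a real symmetric matrix,
counted with multiplicity. -/
def eigenSigma {N : ℕ} (k : ℕ) (A : Matrix (Fin N) (Fin N) ℝ) : ℝ :=
  A.charpoly.roots.esymm k

/-- The `k`-Hessian `S_k[u] = σ_k(Λ)`, where `Λ` are the eigenvalues of `D²u`. -/
def kHessian {N : ℕ} {Ω : Set (EuclideanSpace ℝ (Fin N))} {p : ℝ≥0∞} [Fact (1 ≤ p)]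
    (k : ℕ) (u : SobolevW2 Ω p) (x : EuclideanSpace ℝ (Fin N)) : ℝ :=
  eigenSigma k (SobolevW2.hessian u x)

/-- Weak convergence of a sequence in a real normed space. -/
def TendstoWeakly {E : Type*} [NormedAddCommGroup E] [NormedSpace ℝ E]
    (u : ℕ → E) (v : E) : Prop :=
  Tendsto (fun n => toWeakSpace ℝ E (u n)) atTop (𝓝 (toWeakSpace ℝ E v))

end

/-!
The `k`-Hessian of `u` is, almost everywhere, the sum of the principal `k × k` minors of the matrix
of weak second derivatives (`SobolevW2.kHessian_ae_eq`): that matrix is symmetric, so both are the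
same coefficient of its characteristic polynomial. Hölder's inequality puts each minor in
`L^{p*}` and bounds it by a multiple of `‖u‖ ^ k` (`eLpNorm_kHessian_le`).

The rows of such a minor are gradients, of the functions `∂ₐu`, so minors are null Lagrangians:
integrating by parts against a test function leaves any one of the functions undifferentiated
(`integral_mul_det_fderiv`). Telescoping over the rows, the integrals of the minors of two
families of smooth functions differ by at most a constant times the `L^k` distance of the
*functions*, as long as the gradients stay bounded in `L^k`
(`enorm_integral_mul_det_fderiv_sub_le`). Functions with gradients bounded in `L^k` are
approximated by their mollifications at a uniform rate (`eLpNorm_mollify_sub_le_of_isWeakPartial`),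
and at a fixed scale of mollification weak convergence of the gradients becomes bounded pointwise
convergence (`tendsto_integral_mollify_minor`). Exchanging the two limits gives the weak continuity
of minors against test functions (`tendsto_integral_minor`). This uses only `L^k` bounds on
the whole space; it applies to `∂ₐu` after multiplication by a cutoff supported in `Ω`, because
`k ≤ k p*` (`SobolevW2.tendsto_integral_minor`). No compact embedding is needed.

Weakly convergent sequences in `W^{2,kp*}` are bounded, so their `k`-Hessians are bounded in
`L^{p*}`, and convergence against test functions is weak convergence as soon as test functions are
dense in the dual (`tendstoWeakly_Lp_of_forall_test`). The dual of `L^{p*}` is identified through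
`L^2`, which is possible because `1 < p* ≤ 2` and `Ω` has finite measure
(`exists_memLp_forall_eq_integral`).
-/

/-! ### The `k`-Hessian as a sum of principal minors, and determinants in `L^p` -/

/-- Both sides are, up to the same sign, the coefficient of degree `N - k` of the characteristic
polynomial, which splits over `ℝ` by the spectral theorem. -/
theorem eigenSigma_eq_sum_minors {N k : ℕ} {A : Matrix (Fin N) (Fin N) ℝ} (hA : A.IsSymm)
    (hk : k ≤ N) :
    eigenSigma k A = ∑ s ∈ Finset.univ.powersetCard k,
      (A.submatrix (Subtype.val : s → Fin N) (Subtype.val : s → Fin N)).det := by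
  have hH : A.IsHermitian := by
    rw [Matrix.IsHermitian, Matrix.conjTranspose_eq_transpose_of_trivial]; exact hA
  have hs : A.charpoly.Splits := hH.splits_charpoly
  have hd : A.charpoly.natDegree = N := by simp
  have h1 := Matrix.charpoly_coeff_eq_sum_minors A k (by simpa using hk)
  have h2 := Polynomial.coeff_eq_esymm_roots_of_splits hs (k := N - k) (by rw [hd]; omega)
  rw [Fintype.card_fin] at h1
  rw [h1, hd, Nat.sub_sub_self hk, A.charpoly_monic.leadingCoeff, one_mul] at h2
  exact (mul_left_cancel₀ (pow_ne_zero k (by norm_num)) h2).symm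

/-- The Leibniz formula with the permutation acting on columns, so that the `a`-th factor of each
product comes from the `a`-th row. -/
theorem det_of_eq_sum_perm {ι : Type*} [Fintype ι] [DecidableEq ι] (M : ι → ι → ℝ) :
    (Matrix.of M).det = ∑ σ : Equiv.Perm ι, ((Equiv.Perm.sign σ : ℤ) : ℝ) * ∏ a, M a (σ a) := by
  rw [← Matrix.det_transpose, Matrix.det_apply']
  rfl

section Holder

variable {α ι : Type*} [MeasurableSpace α] {μ : Measure α} [Fintype ι]

theorem aestronglyMeasurable_det [DecidableEq ι] {h : ι → ι → α → ℝ}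
    (hh : ∀ a b, AEStronglyMeasurable (h a b) μ) :
    AEStronglyMeasurable (fun x => (Matrix.of fun a b => h a b x).det) μ := by
  simp only [det_of_eq_sum_perm]
  refine Finset.aestronglyMeasurable_fun_sum _ fun σ _ => ?_
  exact (Finset.aestronglyMeasurable_fun_prod _ fun a _ => hh a (σ a)).const_mul _

variable [Nonempty ι]

/-- Hölder's inequality for a product of `k` functions, all taken in `L^(kp)`. -/
theorem eLpNorm_prod_le_prod_eLpNorm {h : ι → α → ℝ}
    (hh : ∀ i, AEStronglyMeasurable (h i) μ) {p : ℝ≥0∞} (hp0 : p ≠ 0) (hp : p ≠ ⊤) :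
    eLpNorm (fun x => ∏ i, h i x) p μ ≤ ∏ i, eLpNorm (h i) (Fintype.card ι * p) μ := by
  have hk : (0 : ℝ) < Fintype.card ι := by exact_mod_cast Fintype.card_pos
  have hpr : 0 < p.toReal := ENNReal.toReal_pos hp0 hp
  have hkp0 : (Fintype.card ι : ℝ≥0∞) * p ≠ 0 := mul_ne_zero (by simp) hp0
  have hkp : (Fintype.card ι : ℝ≥0∞) * p ≠ ⊤ := ENNReal.mul_ne_top (by simp) hp
  have key : ∫⁻ x, ‖∏ i, h i x‖ₑ ^ p.toReal ∂μ
      ≤ ∏ i, (∫⁻ x, ‖h i x‖ₑ ^ (Fintype.card ι * p.toReal) ∂μ) ^ ((Fintype.card ι : ℝ)⁻¹) := by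
    refine le_trans (le_of_eq ?_) (ENNReal.lintegral_prod_norm_pow_le (μ := μ) Finset.univ
      (f := fun i x => ‖h i x‖ₑ ^ (Fintype.card ι * p.toReal))
      (p := fun _ => (Fintype.card ι : ℝ)⁻¹) (fun i _ => ?_) ?_ ?_)
    · refine lintegral_congr fun x => ?_
      have : ‖∏ i, h i x‖ₑ = ∏ i, ‖h i x‖ₑ := by
        simp only [enorm_eq_nnnorm, nnnorm_prod, ENNReal.ofNNReal_finsetProd]
      rw [this, ← ENNReal.prod_rpow_of_nonneg hpr.le]
      refine Finset.prod_congr rfl fun i _ => ?_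
      rw [← ENNReal.rpow_mul]
      congr 1
      field_simp
    · exact (hh i).enorm.pow_const _
    · simp [hk.ne']
    · intro _ _; positivity
  rw [eLpNorm_eq_lintegral_rpow_enorm_toReal hp0 hp]
  calc _ ≤ (∏ i, (∫⁻ x, ‖h i x‖ₑ ^ (Fintype.card ι * p.toReal) ∂μ) ^ ((Fintype.card ι : ℝ)⁻¹))
            ^ (1 / p.toReal) := by gcongr
    _ = _ := by
      rw [← ENNReal.prod_rpow_of_nonneg (by positivity)]
      refine Finset.prod_congr rfl fun i _ => ?_
      rw [eLpNorm_eq_lintegral_rpow_enorm_toReal hkp0 hkp, ← ENNReal.rpow_mul, ENNReal.toReal_mul,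
        ENNReal.toReal_natCast]
      congr 1
      field_simp

variable [DecidableEq ι]

/-- Hölder's inequality for a determinant whose `a`-th row is bounded by `m a`. -/
theorem eLpNorm_det_le {h : ι → ι → α → ℝ} (hh : ∀ a b, AEStronglyMeasurable (h a b) μ)
    {p : ℝ≥0∞} (hp1 : 1 ≤ p) (hp : p ≠ ⊤) {m : ι → ℝ≥0∞}
    (hm : ∀ a b, eLpNorm (h a b) (Fintype.card ι * p) μ ≤ m a) :
    eLpNorm (fun x => (Matrix.of fun a b => h a b x).det) p μ
      ≤ (Fintype.card ι).factorial * ∏ a, m a := by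
  have hp0 : p ≠ 0 := (zero_lt_one.trans_le hp1).ne'
  simp only [det_of_eq_sum_perm]
  have hmeas : ∀ σ : Equiv.Perm ι, AEStronglyMeasurable
      (fun x => ((Equiv.Perm.sign σ : ℤ) : ℝ) * ∏ a, h a (σ a) x) μ := fun σ =>
    (Finset.aestronglyMeasurable_fun_prod _ fun a _ => hh a (σ a)).const_mul _
  have hsum : (fun x => ∑ σ : Equiv.Perm ι, ((Equiv.Perm.sign σ : ℤ) : ℝ) * ∏ a, h a (σ a) x)
      = ∑ σ : Equiv.Perm ι, fun x => ((Equiv.Perm.sign σ : ℤ) : ℝ) * ∏ a, h a (σ a) x := by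
    ext x; simp
  rw [hsum]
  refine (eLpNorm_sum_le (fun σ _ => hmeas σ) hp1).trans ?_
  have hterm : ∀ σ : Equiv.Perm ι,
      eLpNorm (fun x => ((Equiv.Perm.sign σ : ℤ) : ℝ) * ∏ a, h a (σ a) x) p μ ≤ ∏ a, m a := by
    intro σ
    have h1 : eLpNorm (fun x => ((Equiv.Perm.sign σ : ℤ) : ℝ) * ∏ a, h a (σ a) x) p μ
        = eLpNorm (fun x => ∏ a, h a (σ a) x) p μ := by
      refine eLpNorm_congr_norm_ae (.of_forall fun x => ?_)
      rcases Int.units_eq_one_or (Equiv.Perm.sign σ) with hσ | hσ <;> simp [hσ]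
    rw [h1]
    exact (eLpNorm_prod_le_prod_eLpNorm (fun a => hh a (σ a)) hp0 hp).trans
      (Finset.prod_le_prod' fun a _ => hm a (σ a))
  refine (Finset.sum_le_sum fun σ _ => hterm σ).trans (le_of_eq ?_)
  simp [Fintype.card_perm]

end Holder

/-! ### Minors of gradients are null Lagrangians -/

section IntegrationByParts

variable {E ι : Type*} [NormedAddCommGroup E] [NormedSpace ℝ E] [Fintype ι] [DecidableEq ι]

theorem sum_sign_mul_eq_zero_of_swap {i c : ι} (hic : i ≠ c) (T : Equiv.Perm ι → ℝ)
    (hT : ∀ σ, T (σ * Equiv.swap i c) = T σ) :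
    ∑ σ : Equiv.Perm ι, ((Equiv.Perm.sign σ : ℤ) : ℝ) * T σ = 0 := by
  have h : ∑ σ : Equiv.Perm ι, ((Equiv.Perm.sign σ : ℤ) : ℝ) * T σ
      = -∑ σ : Equiv.Perm ι, ((Equiv.Perm.sign σ : ℤ) : ℝ) * T σ := by
    rw [← Finset.sum_neg_distrib]
    refine (Equiv.sum_comp (Equiv.mulRight (Equiv.swap i c)) _).symm.trans ?_
    refine Finset.sum_congr rfl fun σ _ => ?_
    simp [hT, Equiv.Perm.sign_swap hic]
  linarith

theorem hasFDerivAt_fderiv_apply {F : E → ℝ} (hF : ContDiff ℝ 2 F) (x v : E) :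
    HasFDerivAt (fun y => fderiv ℝ F y v) ((fderiv ℝ (fderiv ℝ F) x).flip v) x := by
  have h : ContDiff ℝ 1 (fderiv ℝ F) := hF.fderiv_right (by norm_num)
  have h1 := (h.differentiable (by norm_num) x).hasFDerivAt
  exact ((ContinuousLinearMap.apply ℝ ℝ v).hasFDerivAt.comp x h1)

/-- The divergence identity behind the null-Lagrangian property of minors. The second derivatives
of the `F a` cancel, because exchanging `i` with another index in a permutation changes its sign
but not the corresponding term. -/
theorem sum_sign_mul_fderiv_prod {F : ι → E → ℝ} (hF : ∀ a, ContDiff ℝ 2 (F a)) {φ : E → ℝ}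
    (hφ : ContDiff ℝ 1 φ) (v : ι → E) (i : ι) (x : E) :
    ∑ σ : Equiv.Perm ι, ((Equiv.Perm.sign σ : ℤ) : ℝ) *
        fderiv ℝ (fun y => φ y * F i y *
          ∏ a ∈ Finset.univ.erase i, fderiv ℝ (F a) y (v (σ a))) x (v (σ i))
      = φ x * (Matrix.of fun a b => fderiv ℝ (F a) x (v b)).det
        + (Matrix.of fun a b => if a = i then F i x * fderiv ℝ φ x (v b)
            else fderiv ℝ (F a) x (v b)).det := by
  have hder : ∀ σ : Equiv.Perm ι,
      fderiv ℝ (fun y => φ y * F i y *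
          ∏ a ∈ Finset.univ.erase i, fderiv ℝ (F a) y (v (σ a))) x (v (σ i))
      = φ x * ∏ a, fderiv ℝ (F a) x (v (σ a))
        + (∏ a, if a = i then F i x * fderiv ℝ φ x (v (σ a)) else fderiv ℝ (F a) x (v (σ a)))
        + φ x * F i x * ∑ c ∈ Finset.univ.erase i,
            (∏ a ∈ (Finset.univ.erase i).erase c, fderiv ℝ (F a) x (v (σ a))) *
              fderiv ℝ (fderiv ℝ (F c)) x (v (σ i)) (v (σ c)) := by
    intro σ
    have h1 := (hφ.differentiable (by norm_num) x).hasFDerivAt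
    have h2 := ((hF i).differentiable (by norm_num) x).hasFDerivAt
    have h3 := HasFDerivAt.finsetProd (u := Finset.univ.erase i)
      (fun c _ => hasFDerivAt_fderiv_apply (hF c) x (v (σ c)))
    have h5 := (h1.mul h2).mul h3
    simp only [Pi.mul_def] at h5
    rw [h5.fderiv]
    rw [← Finset.mul_prod_erase _ _ (Finset.mem_univ i),
      ← Finset.mul_prod_erase _ _ (Finset.mem_univ i)]
    have h4 : (∏ a ∈ Finset.univ.erase i, if a = i then F i x * fderiv ℝ φ x (v (σ a))
        else fderiv ℝ (F a) x (v (σ a)))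
        = ∏ a ∈ Finset.univ.erase i, fderiv ℝ (F a) x (v (σ a)) :=
      Finset.prod_congr rfl fun a ha => if_neg (Finset.ne_of_mem_erase ha)
    rw [h4]
    simp only [_root_.add_apply, _root_.smul_apply, _root_.sum_apply,
      ContinuousLinearMap.flip_apply, smul_eq_mul, if_true]
    ring
  have hzero : ∑ σ : Equiv.Perm ι, ((Equiv.Perm.sign σ : ℤ) : ℝ) *
      (φ x * F i x * ∑ c ∈ Finset.univ.erase i,
        (∏ a ∈ (Finset.univ.erase i).erase c, fderiv ℝ (F a) x (v (σ a))) *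
          fderiv ℝ (fderiv ℝ (F c)) x (v (σ i)) (v (σ c))) = 0 := by
    simp only [Finset.mul_sum]
    rw [Finset.sum_comm]
    refine Finset.sum_eq_zero fun c hc => ?_
    have hci : c ≠ i := Finset.ne_of_mem_erase hc
    refine sum_sign_mul_eq_zero_of_swap hci.symm _ fun σ => ?_
    have hsymm := ((hF c).contDiffAt (x := x)).isSymmSndFDerivAt (by simp)
    have hprod : (∏ a ∈ (Finset.univ.erase i).erase c,
          fderiv ℝ (F a) x (v ((σ * Equiv.swap i c) a)))
        = ∏ a ∈ (Finset.univ.erase i).erase c, fderiv ℝ (F a) x (v (σ a)) := by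
      refine Finset.prod_congr rfl fun a ha => ?_
      simp only [Finset.mem_erase] at ha
      rw [Equiv.Perm.mul_apply, Equiv.swap_apply_of_ne_of_ne ha.2.1 ha.1]
    rw [hprod]
    simp only [Equiv.Perm.mul_apply, Equiv.swap_apply_left, Equiv.swap_apply_right]
    rw [hsymm.eq]
  simp only [hder, mul_add, Finset.sum_add_distrib]
  rw [hzero, add_zero, det_of_eq_sum_perm, det_of_eq_sum_perm, Finset.mul_sum]
  congr 1
  refine Finset.sum_congr rfl fun σ _ => by ring

theorem continuous_det_fderiv {F : ι → E → ℝ} (hF : ∀ a, ContDiff ℝ 2 (F a)) (v : ι → E) :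
    Continuous fun x => (Matrix.of fun a b => fderiv ℝ (F a) x (v b)).det := by
  refine Continuous.matrix_det (continuous_matrix fun a b => ?_)
  exact ((hF a).continuous_fderiv (by norm_num)).clm_apply continuous_const

variable [FiniteDimensional ℝ E] [MeasurableSpace E] [BorelSpace E] {μ : Measure E}
  [μ.IsAddHaarMeasure]

theorem integral_fderiv_apply_eq_zero {f : E → ℝ} (hf : ContDiff ℝ 1 f) (hc : HasCompactSupport f)
    (v : E) : ∫ x, fderiv ℝ f x v ∂μ = 0 := by
  have hcont : Continuous fun x => fderiv ℝ f x v :=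
    (hf.continuous_fderiv (by norm_num)).clm_apply continuous_const
  have h := integral_mul_fderiv_eq_neg_fderiv_mul_of_integrable (μ := μ) (f := fun _ => (1 : ℝ))
    (g := f) (v := v) (by simp)
    (by simpa using hcont.integrable_of_hasCompactSupport (hc.fderiv_apply (𝕜 := ℝ) v))
    (by simpa using hf.continuous.integrable_of_hasCompactSupport hc)
    (by simp) (fun x _ => hf.differentiable (by norm_num) x)
  simpa using h

/-- Minors of gradients are null Lagrangians: integration by parts moves the derivative from the
`i`-th row onto `φ`, leaving `F i` undifferentiated. -/
theorem integral_mul_det_fderiv {F : ι → E → ℝ} (hF : ∀ a, ContDiff ℝ 2 (F a)) {φ : E → ℝ}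
    (hφ : ContDiff ℝ 1 φ) (hc : HasCompactSupport φ) (v : ι → E) (i : ι) :
    ∫ x, φ x * (Matrix.of fun a b => fderiv ℝ (F a) x (v b)).det ∂μ
      = -∫ x, (Matrix.of fun a b => if a = i then F i x * fderiv ℝ φ x (v b)
            else fderiv ℝ (F a) x (v b)).det ∂μ := by
  have hcd : ∀ σ : Equiv.Perm ι, ContDiff ℝ 1 (fun y => φ y * F i y *
      ∏ a ∈ Finset.univ.erase i, fderiv ℝ (F a) y (v (σ a))) := fun σ =>
    (hφ.mul ((hF i).of_le (by norm_num))).mul (contDiff_prod fun a _ =>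
      ((hF a).fderiv_right (m := 1) (by norm_num)).clm_apply contDiff_const)
  have hcs : ∀ σ : Equiv.Perm ι, HasCompactSupport (fun y => φ y * F i y *
      ∏ a ∈ Finset.univ.erase i, fderiv ℝ (F a) y (v (σ a))) := fun σ =>
    (hc.mul_right).mul_right
  have h0 : ∫ x, (∑ σ : Equiv.Perm ι, ((Equiv.Perm.sign σ : ℤ) : ℝ) *
        fderiv ℝ (fun y => φ y * F i y *
          ∏ a ∈ Finset.univ.erase i, fderiv ℝ (F a) y (v (σ a))) x (v (σ i))) ∂μ = 0 := by
    rw [integral_finsetSum]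
    · refine Finset.sum_eq_zero fun σ _ => ?_
      rw [integral_const_mul, integral_fderiv_apply_eq_zero (hcd σ) (hcs σ), mul_zero]
    · intro σ _
      refine Integrable.const_mul ?_ _
      exact (((hcd σ).continuous_fderiv (by norm_num)).clm_apply
        continuous_const).integrable_of_hasCompactSupport ((hcs σ).fderiv_apply (𝕜 := ℝ) _)
  have hi1 : Integrable (fun x => φ x * (Matrix.of fun a b => fderiv ℝ (F a) x (v b)).det) μ :=
    (hφ.continuous.mul (continuous_det_fderiv hF v)).integrable_of_hasCompactSupport hc.mul_right
  have hi2 : Integrable (fun x => (Matrix.of fun a b => if a = i then F i x * fderiv ℝ φ x (v b)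
            else fderiv ℝ (F a) x (v b)).det) μ := by
    refine Continuous.integrable_of_hasCompactSupport ?_ ?_
    · refine Continuous.matrix_det (continuous_matrix fun a b => ?_)
      by_cases h : a = i
      · simp only [Matrix.of_apply, h, if_true]
        exact (hF i).continuous.mul
          ((hφ.continuous_fderiv (by norm_num)).clm_apply continuous_const)
      · simpa [h] using ((hF a).continuous_fderiv (by norm_num)).clm_apply continuous_const
    · refine HasCompactSupport.intro (hc.fderiv (𝕜 := ℝ)) fun x hx => ?_
      refine Matrix.det_eq_zero_of_row_eq_zero i fun b => ?_
      simp [image_eq_zero_of_notMem_tsupport hx]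
  simp only [sum_sign_mul_fderiv_prod hF hφ v i] at h0
  rw [integral_add hi1 hi2] at h0
  linarith

end IntegrationByParts

theorem Finset.prod_ite_eq_mul_pow {ι R : Type*} [Fintype ι] [DecidableEq ι] [CommMonoid R] (i : ι)
    (x y : R) : ∏ a : ι, (if a = i then x else y) = x * y ^ (Fintype.card ι - 1) := by
  rw [← Finset.mul_prod_erase _ _ (Finset.mem_univ i), if_pos rfl,
    Finset.prod_congr rfl fun a ha => if_neg (Finset.ne_of_mem_erase ha), Finset.prod_const,
    Finset.card_erase_of_mem (Finset.mem_univ i), Finset.card_univ]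

/-- The difference of two determinants, telescoped over the rows. -/
theorem det_sub_det_eq_sum {ι : Type*} [Fintype ι] [LinearOrder ι] (A B : ι → ι → ℝ) :
    (Matrix.of A).det - (Matrix.of B).det = ∑ i, (Matrix.of fun a =>
      if a < i then A a else if a = i then A a - B a else B a).det := by
  have h := (Matrix.detRowAlternating (R := ℝ)
    (n := ι)).toMultilinearMap.map_piecewise_sub_map_piecewise A B 0 Finset.univ
  simpa using! h

/-- The determinant is Lipschitz on bounded sets, as a map between `L^p` spaces. -/
theorem eLpNorm_det_sub_le {α ι : Type*} [MeasurableSpace α] {μ : Measure α} [Fintype ι]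
    [LinearOrder ι] [Nonempty ι] {g h : ι → ι → α → ℝ}
    (hg : ∀ a b, AEStronglyMeasurable (g a b) μ) (hh : ∀ a b, AEStronglyMeasurable (h a b) μ)
    {p : ℝ≥0∞} (hp1 : 1 ≤ p) (hp : p ≠ ⊤) {M η : ℝ≥0∞}
    (hMg : ∀ a b, eLpNorm (g a b) (Fintype.card ι * p) μ ≤ M)
    (hMh : ∀ a b, eLpNorm (h a b) (Fintype.card ι * p) μ ≤ M)
    (hη : ∀ a b, eLpNorm (g a b - h a b) (Fintype.card ι * p) μ ≤ η) :
    eLpNorm (fun x => (Matrix.of fun a b => g a b x).det - (Matrix.of fun a b => h a b x).det) p μ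
      ≤ Fintype.card ι * ((Fintype.card ι).factorial * (η * M ^ (Fintype.card ι - 1))) := by
  have hR : ∀ i a b, AEStronglyMeasurable
      (if a < i then g a b else if a = i then g a b - h a b else h a b) μ := by
    intro i a b
    split_ifs
    exacts [hg a b, (hg a b).sub (hh a b), hh a b]
  have heq : (fun x => (Matrix.of fun a b => g a b x).det - (Matrix.of fun a b => h a b x).det)
      = ∑ i, fun x => (Matrix.of fun a b =>
        (if a < i then g a b else if a = i then g a b - h a b else h a b) x).det := by
    ext x
    rw [det_sub_det_eq_sum, Finset.sum_apply]
    refine Finset.sum_congr rfl fun i _ => ?_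
    congr 2
    ext a b
    split_ifs <;> rfl
  rw [heq]
  refine (eLpNorm_sum_le (fun i _ => aestronglyMeasurable_det (hR i)) hp1).trans ?_
  have hterm : ∀ i : ι, eLpNorm (fun x => (Matrix.of fun a b =>
        (if a < i then g a b else if a = i then g a b - h a b else h a b) x).det) p μ
      ≤ (Fintype.card ι).factorial * (η * M ^ (Fintype.card ι - 1)) := by
    intro i
    rw [← Finset.prod_ite_eq_mul_pow i]
    refine eLpNorm_det_le (hR i) hp1 hp fun a b => ?_
    split_ifs with h1 h2 h2
    exacts [absurd h2 h1.ne, hMg a b, hη a b, hMh a b]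
  refine (Finset.sum_le_sum fun i _ => hterm i).trans (le_of_eq ?_)
  simp

section NullLagrangian

variable {E ι : Type*} [NormedAddCommGroup E] [NormedSpace ℝ E] [Fintype ι] [LinearOrder ι]
  [Nonempty ι] [FiniteDimensional ℝ E] [MeasurableSpace E] [BorelSpace E] {μ : Measure E}
  [μ.IsAddHaarMeasure]

/-- After moving one derivative onto `φ`, the function `F i` enters only through its own norm. -/
theorem enorm_integral_mul_det_fderiv_le {F : ι → E → ℝ} (hF : ∀ a, ContDiff ℝ 2 (F a))
    {φ : E → ℝ} (hφ : ContDiff ℝ 1 φ) (hc : HasCompactSupport φ) (v : ι → E) (i : ι)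
    {L η M : ℝ≥0∞} (hL : ∀ b x, ‖fderiv ℝ φ x (v b)‖ₑ ≤ L)
    (hη : eLpNorm (F i) (Fintype.card ι) μ ≤ η)
    (hM : ∀ a b, a ≠ i → eLpNorm (fun x => fderiv ℝ (F a) x (v b)) (Fintype.card ι) μ ≤ M) :
    ‖∫ x, φ x * (Matrix.of fun a b => fderiv ℝ (F a) x (v b)).det ∂μ‖ₑ
      ≤ (Fintype.card ι).factorial * (L * η * M ^ (Fintype.card ι - 1)) := by
  rw [integral_mul_det_fderiv hF hφ hc v i, enorm_neg]
  refine (enorm_integral_le_lintegral_enorm _).trans ?_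
  rw [← eLpNorm_one_eq_lintegral_enorm, ← Finset.prod_ite_eq_mul_pow i]
  refine eLpNorm_det_le (fun a b => ?_) le_rfl ENNReal.one_ne_top fun a b => ?_
  · by_cases h : a = i
    · simp only [h, if_true]
      exact ((hF i).continuous.mul ((hφ.continuous_fderiv (by norm_num)).clm_apply
        continuous_const)).aestronglyMeasurable
    · simp only [h, if_false]
      exact (((hF a).continuous_fderiv (by norm_num)).clm_apply
        continuous_const).aestronglyMeasurable
  · rw [mul_one]
    by_cases h : a = i
    · simp only [h, if_true]
      calc _ ≤ L * eLpNorm (F i) (Fintype.card ι) μ := by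
            refine eLpNorm_le_mul_eLpNorm_of_ae_le_mul'' _
              (hF i).continuous.aestronglyMeasurable (.of_forall fun x => ?_)
            rw [enorm_mul, mul_comm]
            gcongr
            exact hL b x
        _ ≤ _ := by gcongr
    · simpa only [h, if_false] using hM a b h

/-- Minors of gradients are controlled by the distance of the *functions* in `L^k`, as long as
the gradients stay bounded in `L^k`. -/
theorem enorm_integral_mul_det_fderiv_sub_le {A B : ι → E → ℝ} (hA : ∀ a, ContDiff ℝ 2 (A a))
    (hB : ∀ a, ContDiff ℝ 2 (B a)) {φ : E → ℝ} (hφ : ContDiff ℝ 1 φ) (hc : HasCompactSupport φ)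
    (v : ι → E) {L η M : ℝ≥0∞} (hL : ∀ b x, ‖fderiv ℝ φ x (v b)‖ₑ ≤ L)
    (hη : ∀ a, eLpNorm (A a - B a) (Fintype.card ι) μ ≤ η)
    (hMA : ∀ a b, eLpNorm (fun x => fderiv ℝ (A a) x (v b)) (Fintype.card ι) μ ≤ M)
    (hMB : ∀ a b, eLpNorm (fun x => fderiv ℝ (B a) x (v b)) (Fintype.card ι) μ ≤ M) :
    ‖∫ x, φ x * (Matrix.of fun a b => fderiv ℝ (A a) x (v b)).det ∂μ
        - ∫ x, φ x * (Matrix.of fun a b => fderiv ℝ (B a) x (v b)).det ∂μ‖ₑ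
      ≤ Fintype.card ι * ((Fintype.card ι).factorial * (L * η * M ^ (Fintype.card ι - 1))) := by
  have hint : ∀ F : ι → E → ℝ, (∀ a, ContDiff ℝ 2 (F a)) →
      Integrable (fun x => φ x * (Matrix.of fun a b => fderiv ℝ (F a) x (v b)).det) μ :=
    fun F hF => (hφ.continuous.mul
      (continuous_det_fderiv hF v)).integrable_of_hasCompactSupport hc.mul_right
  -- The rows of the `i`-th telescoping term are again gradients; only the `i`-th is a difference.
  let R : ι → ι → E → ℝ := fun i a => if a < i then A a else if a = i then A a - B a else B a
  have hR : ∀ i a, ContDiff ℝ 2 (R i a) := by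
    intro i a
    simp only [R]
    split_ifs
    exacts [hA a, (hA a).sub (hB a), hB a]
  have hdet : ∀ x, φ x * (Matrix.of fun a b => fderiv ℝ (A a) x (v b)).det
        - φ x * (Matrix.of fun a b => fderiv ℝ (B a) x (v b)).det
      = ∑ i, φ x * (Matrix.of fun a b => fderiv ℝ (R i a) x (v b)).det := by
    intro x
    rw [← mul_sub, det_sub_det_eq_sum, Finset.mul_sum]
    refine Finset.sum_congr rfl fun i _ => ?_
    congr 3
    ext a b
    simp only [R]
    split_ifs
    · rfl
    · rw [fderiv_sub ((hA a).differentiable (by norm_num) x)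
        ((hB a).differentiable (by norm_num) x)]
      rfl
    · rfl
  rw [← integral_sub (hint A hA) (hint B hB), integral_congr_ae (.of_forall hdet),
    integral_finsetSum _ fun i _ => hint _ (hR i)]
  have hterm : ∀ i, ‖∫ x, φ x * (Matrix.of fun a b => fderiv ℝ (R i a) x (v b)).det ∂μ‖ₑ
      ≤ (Fintype.card ι).factorial * (L * η * M ^ (Fintype.card ι - 1)) := by
    intro i
    refine enorm_integral_mul_det_fderiv_le (hR i) hφ hc v i hL (by simpa [R] using hη i) ?_
    intro a b hai
    simp only [R, if_neg hai]
    split_ifs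
    exacts [hMA a b, hMB a b]
  refine (enorm_sum_le _ _).trans ((Finset.sum_le_sum fun i _ => hterm i).trans (le_of_eq ?_))
  simp

end NullLagrangian

/-! ### Mollification -/

section Jensen

/-- The `L^p` norm of an average is at most the supremum of the `L^p` norms of the functions
averaged. -/
theorem eLpNorm_integral_le_of_ae_le {X Y : Type*} [MeasurableSpace X] [MeasurableSpace Y]
    {ν : Measure X} [SFinite ν] {μ : Measure Y} [IsProbabilityMeasure μ] {G : X → Y → ℝ}
    (hG : AEStronglyMeasurable (Function.uncurry G) (ν.prod μ)) {p : ℝ≥0∞} (hp1 : 1 ≤ p)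
    (hp : p ≠ ⊤) {C : ℝ≥0∞} (h : ∀ᵐ y ∂μ, eLpNorm (fun x => G x y) p ν ≤ C) :
    eLpNorm (fun x => ∫ y, G x y ∂μ) p ν ≤ C := by
  have hp0 : p ≠ 0 := (zero_lt_one.trans_le hp1).ne'
  have hpr : 0 < p.toReal := ENNReal.toReal_pos hp0 hp
  have h1 : ∫⁻ x, ‖∫ y, G x y ∂μ‖ₑ ^ p.toReal ∂ν ≤ ∫⁻ x, ∫⁻ y, ‖G x y‖ₑ ^ p.toReal ∂μ ∂ν := by
    refine lintegral_mono_ae ?_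
    filter_upwards [hG.prodMk_left] with x hx
    have h2 : ‖∫ y, G x y ∂μ‖ₑ ≤ eLpNorm (G x) p μ :=
      ((enorm_integral_le_lintegral_enorm _).trans_eq eLpNorm_one_eq_lintegral_enorm.symm).trans
        (eLpNorm_le_eLpNorm_of_exponent_le hp1 hx)
    rw [eLpNorm_eq_lintegral_rpow_enorm_toReal hp0 hp, one_div] at h2
    exact (ENNReal.le_rpow_inv_iff hpr).1 h2
  have h3 : ∫⁻ x, ∫⁻ y, ‖G x y‖ₑ ^ p.toReal ∂μ ∂ν ≤ C ^ p.toReal := by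
    rw [lintegral_lintegral_swap (hG.enorm.pow_const _)]
    calc _ ≤ ∫⁻ _, C ^ p.toReal ∂μ := by
          refine lintegral_mono_ae ?_
          filter_upwards [h] with y hy
          rw [eLpNorm_eq_lintegral_rpow_enorm_toReal hp0 hp, one_div] at hy
          exact (ENNReal.rpow_inv_le_iff hpr).1 hy
      _ = _ := by simp
  rw [eLpNorm_eq_lintegral_rpow_enorm_toReal hp0 hp, one_div]
  exact (ENNReal.rpow_inv_le_iff hpr).2 (h1.trans h3)

end Jensen

section Mollify

variable {E : Type*} [NormedAddCommGroup E] [NormedSpace ℝ E]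
  [FiniteDimensional ℝ E] [MeasurableSpace E] {μ : Measure E}

open scoped Convolution in
/-- The mollification of `f` by the normalised smooth bump function `b`. -/
noncomputable def mollify (μ : Measure E) (b : ContDiffBump (0 : E)) (f : E → ℝ) : E → ℝ :=
  f ⋆[ContinuousLinearMap.mul ℝ ℝ, μ] b.normed μ

theorem mollify_apply (b : ContDiffBump (0 : E)) (f : E → ℝ) (x : E) :
    mollify μ b f x = ∫ t, f t * b.normed μ (x - t) ∂μ := by
  rw [mollify, convolution_mul]

/-- The probability measure whose density is the normalised bump function `b`. -/
noncomputable def bumpMeasure (μ : Measure E) (b : ContDiffBump (0 : E)) : Measure E :=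
  μ.withDensity fun x => ENNReal.ofReal (b.normed μ x)

variable [BorelSpace E] [μ.IsAddHaarMeasure]

instance (b : ContDiffBump (0 : E)) : IsProbabilityMeasure (bumpMeasure μ b) := by
  refine ⟨?_⟩
  rw [bumpMeasure, withDensity_apply _ MeasurableSet.univ, Measure.restrict_univ,
    ← ofReal_integral_eq_lintegral_ofReal b.integrable_normed (.of_forall b.nonneg_normed),
    b.integral_normed, ENNReal.ofReal_one]

theorem ae_bumpMeasure_norm_lt (b : ContDiffBump (0 : E)) :
    ∀ᵐ y ∂bumpMeasure μ b, ‖y‖ < b.rOut := by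
  rw [bumpMeasure, ae_withDensity_iff (by
    exact (b.continuous_normed.measurable).ennreal_ofReal)]
  refine .of_forall fun y hy => ?_
  have : y ∈ Function.support (b.normed μ) := fun h => hy (by rw [h, ENNReal.ofReal_zero])
  rw [b.support_normed_eq] at this
  simpa using this

/-- A mollification is an average of translations over a probability measure. -/
theorem mollify_eq_integral_bumpMeasure (b : ContDiffBump (0 : E)) (f : E → ℝ) (x : E) :
    mollify μ b f x = ∫ y, f (x - y) ∂bumpMeasure μ b := by
  rw [mollify, convolution_mul_swap, bumpMeasure, integral_withDensity_eq_integral_toReal_smul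
    (b.continuous_normed.measurable.ennreal_ofReal) (.of_forall fun _ => ENNReal.ofReal_lt_top)]
  refine integral_congr_ae (.of_forall fun y => ?_)
  simp [ENNReal.toReal_ofReal (b.nonneg_normed y), mul_comm]

theorem integrable_comp_sub_bumpMeasure (b : ContDiffBump (0 : E)) {f : E → ℝ}
    (hf : LocallyIntegrable f μ) (x : E) :
    Integrable (fun y => f (x - y)) (bumpMeasure μ b) := by
  rw [bumpMeasure, integrable_withDensity_iff_integrable_smul'
    (b.continuous_normed.measurable.ennreal_ofReal) (.of_forall fun _ => ENNReal.ofReal_lt_top)]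
  have h := (b.hasCompactSupport_normed (μ := μ)).convolutionExists_right
    (ContinuousLinearMap.mul ℝ ℝ) hf b.continuous_normed x
  have h2 := h.integrable_swap
  refine h2.congr (.of_forall fun y => ?_)
  simp [ENNReal.toReal_ofReal (b.nonneg_normed y), mul_comm]

theorem contDiff_mollify (b : ContDiffBump (0 : E)) {f : E → ℝ}
    (hf : LocallyIntegrable f μ) {n : ℕ∞} : ContDiff ℝ n (mollify μ b f) :=
  (b.hasCompactSupport_normed).contDiff_convolution_right _ hf b.contDiff_normed

/-- The derivative of a mollification is the mollification of the weak derivative: the defining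
identity of `g` is applied to the translated reflected kernel `t ↦ b (x - t)`. -/
theorem fderiv_mollify (b : ContDiffBump (0 : E)) {f g : E → ℝ}
    (hf : LocallyIntegrable f μ) {v : E}
    (h : ∀ ψ : E → ℝ, ContDiff ℝ ∞ ψ → HasCompactSupport ψ →
      ∫ x, f x * fderiv ℝ ψ x v ∂μ = -∫ x, g x * ψ x ∂μ) (x : E) :
    fderiv ℝ (mollify μ b f) x v = mollify μ b g x := by
  have hb : ContDiff ℝ 1 (b.normed μ) := b.contDiff_normed
  have hbi : ContDiff ℝ ∞ (b.normed μ) := b.contDiff_normed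
  have hc := b.hasCompactSupport_normed (μ := μ)
  rw [mollify, (hc.hasFDerivAt_convolution_right (ContinuousLinearMap.mul ℝ ℝ) hf hb x).fderiv,
    convolution_precompR_apply _ hf (hc.fderiv ℝ) (hb.continuous_fderiv one_ne_zero),
    convolution_mul, mollify_apply]
  have hψ : ContDiff ℝ ∞ fun t => b.normed μ (x - t) := hbi.comp (contDiff_const.sub contDiff_id)
  have hψc : HasCompactSupport fun t => b.normed μ (x - t) :=
    hc.comp_homeomorph (Homeomorph.subLeft x)
  have hder : ∀ t, fderiv ℝ (fun t => b.normed μ (x - t)) t v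
      = -fderiv ℝ (b.normed μ) (x - t) v := by
    intro t
    have h1 := (hb.differentiable one_ne_zero (x - t)).hasFDerivAt.comp t
      ((hasFDerivAt_const x t).sub (hasFDerivAt_id t))
    have h2 : fderiv ℝ (fun t => b.normed μ (x - t)) t = _ := h1.fderiv
    rw [h2]; simp
  have := h _ hψ hψc
  simp only [hder, mul_neg, integral_neg] at this
  linarith

theorem eLpNorm_comp_sub_right {G : Type*} [AddGroup G] [MeasurableSpace G] [MeasurableAdd G]
    {μ : Measure G} [μ.IsAddRightInvariant] {f : G → ℝ} {p : ℝ≥0∞}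
    (hf : AEStronglyMeasurable f μ) (y : G) :
    eLpNorm (fun x => f (x - y)) p μ = eLpNorm f p μ :=
  eLpNorm_comp_measurePreserving hf (measurePreserving_sub_right μ y)

theorem aestronglyMeasurable_comp_sub (b : ContDiffBump (0 : E)) {f : E → ℝ}
    (hf : AEStronglyMeasurable f μ) :
    AEStronglyMeasurable (Function.uncurry fun x y => f (x - y)) (μ.prod (bumpMeasure μ b)) := by
  have hac : μ.prod (bumpMeasure μ b) ≪ μ.prod μ :=
    Measure.AbsolutelyContinuous.rfl.prod (withDensity_absolutelyContinuous _ _)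
  exact (hf.comp_quasiMeasurePreserving (quasiMeasurePreserving_sub μ μ)).mono_ac hac

theorem eLpNorm_mollify_le (b : ContDiffBump (0 : E)) {f : E → ℝ} {p : ℝ≥0∞} (hp1 : 1 ≤ p)
    (hp : p ≠ ⊤) (hf : AEStronglyMeasurable f μ) :
    eLpNorm (mollify μ b f) p μ ≤ eLpNorm f p μ := by
  have : mollify μ b f = fun x => ∫ y, f (x - y) ∂bumpMeasure μ b :=
    funext (mollify_eq_integral_bumpMeasure b f)
  rw [this]
  exact eLpNorm_integral_le_of_ae_le (aestronglyMeasurable_comp_sub b hf) hp1 hp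
    (.of_forall fun y => (eLpNorm_comp_sub_right hf y).le)

/-- A mollification is an average of translations by vectors shorter than the radius of the kernel,
hence as close to `f` as these translations are. -/
theorem eLpNorm_mollify_sub_le (b : ContDiffBump (0 : E)) {f : E → ℝ} {p : ℝ≥0∞} (hp1 : 1 ≤ p)
    (hp : p ≠ ⊤) (hf : LocallyIntegrable f μ) {C : ℝ≥0∞}
    (h : ∀ y, ‖y‖ < b.rOut → eLpNorm (fun x => f (x - y) - f x) p μ ≤ C) :
    eLpNorm (mollify μ b f - f) p μ ≤ C := by
  have : mollify μ b f - f = fun x => ∫ y, (f (x - y) - f x) ∂bumpMeasure μ b := by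
    ext x
    rw [integral_sub (integrable_comp_sub_bumpMeasure b hf x) (integrable_const _), integral_const,
      Pi.sub_apply, mollify_eq_integral_bumpMeasure]
    simp
  rw [this]
  have hm : AEStronglyMeasurable (Function.uncurry fun x y => f (x - y) - f x)
      (μ.prod (bumpMeasure μ b)) :=
    (aestronglyMeasurable_comp_sub b hf.aestronglyMeasurable).sub
      hf.aestronglyMeasurable.comp_fst
  refine eLpNorm_integral_le_of_ae_le hm hp1 hp ?_
  filter_upwards [ae_bumpMeasure_norm_lt b] with y hy using h y hy

/-- Continuity of translations in `L^p`. -/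
theorem tendsto_eLpNorm_translate_sub {f : E → ℝ} {p : ℝ≥0∞} (hp1 : 1 ≤ p) (hp : p ≠ ⊤)
    (hf : MemLp f p μ) :
    Tendsto (fun y => eLpNorm (fun x => f (x - y) - f x) p μ) (𝓝 0) (𝓝 0) := by
  have : Fact (1 ≤ p) := ⟨hp1⟩
  let g : C(E, C(E, E)) := ContinuousMap.curry ⟨fun q : E × E => q.2 - q.1, by fun_prop⟩
  have hg : ∀ y, MeasurePreserving (g y) μ μ := fun y => measurePreserving_sub_right μ y
  have h : Continuous fun y => Lp.compMeasurePreserving (g y) (hg y) hf.toLp :=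
    Continuous.compMeasurePreservingLp continuous_const g.continuous hg hp
  have h2 := (h.tendsto 0)
  rw [tendsto_iff_edist_tendsto_0] at h2
  refine h2.congr fun y => ?_
  rw [Lp.edist_def]
  refine eLpNorm_congr_ae ?_
  have e1 : ∀ z, (Lp.compMeasurePreserving (g z) (hg z) hf.toLp : E → ℝ)
      =ᵐ[μ] fun x => f (x - z) := fun z =>
    (Lp.coeFn_compMeasurePreserving _ (hg z)).trans
      ((hg z).quasiMeasurePreserving.ae_eq_comp hf.coeFn_toLp)
  filter_upwards [e1 y, e1 0] with x h1 h2
  rw [Pi.sub_apply, h1, h2, sub_zero]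

/-- The increment of `F` along `y` is the average of the derivative in direction `y` over the
segment, so translating by `y` moves `F` by at most the `L^p` norm of that derivative. -/
theorem eLpNorm_translate_sub_le {F : E → ℝ} (hF : ContDiff ℝ 1 F) {p : ℝ≥0∞} (hp1 : 1 ≤ p)
    (hp : p ≠ ⊤) {C : ℝ≥0∞} (y : E) (h : eLpNorm (fun x => fderiv ℝ F x y) p μ ≤ C) :
    eLpNorm (fun x => F (x - y) - F x) p μ ≤ C := by
  have hcont : Continuous fun q : E × ℝ => -fderiv ℝ F (q.1 - q.2 • y) y :=
    (((hF.continuous_fderiv one_ne_zero).comp (by fun_prop)).clm_apply continuous_const).neg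
  have hftc : (fun x => F (x - y) - F x)
      = fun x => ∫ t in Set.Ioc (0 : ℝ) 1, -fderiv ℝ F (x - t • y) y := by
    ext x
    rw [← intervalIntegral.integral_of_le zero_le_one]
    have hd : ∀ t ∈ Set.uIcc (0 : ℝ) 1,
        HasDerivAt (fun t : ℝ => F (x - t • y)) (-fderiv ℝ F (x - t • y) y) t := by
      intro t _
      have h1 := (hF.differentiable one_ne_zero (x - t • y)).hasFDerivAt
      have h2 : HasDerivAt (fun t : ℝ => x - t • y) (-y) t := by
        simpa using ((hasDerivAt_id t).smul_const y).const_sub x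
      simpa using! h1.comp_hasDerivAt t h2
    rw [intervalIntegral.integral_eq_sub_of_hasDerivAt hd]
    · simp
    · exact (hcont.comp (continuous_const.prodMk continuous_id)).intervalIntegrable _ _
  rw [hftc]
  have : IsProbabilityMeasure (volume.restrict (Set.Ioc (0 : ℝ) 1)) := ⟨by simp⟩
  refine eLpNorm_integral_le_of_ae_le (hcont.aestronglyMeasurable) hp1 hp (.of_forall fun t => ?_)
  have hm : AEStronglyMeasurable (fun x => fderiv ℝ F x y) μ :=
    ((hF.continuous_fderiv one_ne_zero).clm_apply continuous_const).aestronglyMeasurable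
  refine le_trans (le_of_eq ?_) h
  rw [← eLpNorm_comp_sub_right hm (t • y)]
  exact eLpNorm_neg (fun x => fderiv ℝ F (x - t • y) y) p μ

/-- A bump function supported in the ball of radius `1 / (m + 1)`. -/
noncomputable def bumpSeq (E : Type*) [NormedAddCommGroup E] (m : ℕ) : ContDiffBump (0 : E) :=
  ⟨1 / ((m : ℝ) + 1) / 2, 1 / ((m : ℝ) + 1), half_pos Nat.one_div_pos_of_nat,
    half_lt_self Nat.one_div_pos_of_nat⟩

theorem tendsto_eLpNorm_mollify_sub {f : E → ℝ} {p : ℝ≥0∞} (hp1 : 1 ≤ p) (hp : p ≠ ⊤)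
    (hf : MemLp f p μ) :
    Tendsto (fun m => eLpNorm (mollify μ (bumpSeq E m) f - f) p μ) atTop (𝓝 0) := by
  rw [ENNReal.tendsto_nhds_zero]
  intro ε hε
  have h := (tendsto_eLpNorm_translate_sub hp1 hp hf).eventually (ge_mem_nhds hε)
  obtain ⟨δ, hδ, h1⟩ := Metric.eventually_nhds_iff.1 h
  filter_upwards [(tendsto_one_div_add_atTop_nhds_zero_nat (𝕜 := ℝ)).eventually_lt_const hδ]
    with m hm
  refine eLpNorm_mollify_sub_le _ hp1 hp (hf.locallyIntegrable hp1) fun y hy => h1 ?_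
  rw [dist_zero_right]
  exact lt_trans hy hm

end Mollify

section MollifyBounds

variable {E : Type*} [NormedAddCommGroup E] [NormedSpace ℝ E]
  [FiniteDimensional ℝ E] [MeasurableSpace E] [BorelSpace E] {μ : Measure E}
  [μ.IsAddHaarMeasure]

/-- At a fixed scale mollification maps `L^p` boundedly into `L^∞`, because the kernel has a bounded
density. -/
theorem exists_enorm_mollify_le (b : ContDiffBump (0 : E)) {p : ℝ≥0∞} (hp1 : 1 ≤ p)
    (hp : p ≠ ⊤) : ∃ R : ℝ≥0∞, R ≠ ⊤ ∧ ∀ (f : E → ℝ), AEStronglyMeasurable f μ → ∀ x,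
      ‖mollify μ b f x‖ₑ ≤ R * eLpNorm f p μ := by
  obtain ⟨C, hC⟩ := b.hasCompactSupport_normed (μ := μ).exists_bound_of_continuous
    b.continuous_normed
  have hle : bumpMeasure μ b ≤ ENNReal.ofReal C • μ := by
    rw [bumpMeasure, ← withDensity_const]
    exact withDensity_mono (.of_forall fun x =>
      ENNReal.ofReal_le_ofReal ((le_abs_self _).trans (hC x)))
  refine ⟨ENNReal.ofReal C ^ (1 / p).toReal, by finiteness, fun f hf x => ?_⟩
  have hmp := Measure.measurePreserving_sub_left μ x
  have hm : AEStronglyMeasurable (fun y => f (x - y)) μ := hf.comp_measurePreserving hmp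
  rw [mollify_eq_integral_bumpMeasure]
  calc ‖∫ y, f (x - y) ∂bumpMeasure μ b‖ₑ
      ≤ eLpNorm (fun y => f (x - y)) 1 (bumpMeasure μ b) := by
        rw [eLpNorm_one_eq_lintegral_enorm]; exact enorm_integral_le_lintegral_enorm _
    _ ≤ eLpNorm (fun y => f (x - y)) p (bumpMeasure μ b) :=
        eLpNorm_le_eLpNorm_of_exponent_le hp1
          (hm.mono_ac (withDensity_absolutelyContinuous _ _))
    _ ≤ eLpNorm (fun y => f (x - y)) p (ENNReal.ofReal C • μ) := eLpNorm_mono_measure _ hle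
    _ = ENNReal.ofReal C ^ (1 / p).toReal * eLpNorm (fun y => f (x - y)) p μ := by
        rw [eLpNorm_smul_measure_of_ne_top hp, smul_eq_mul]
    _ = _ := by rw [← eLpNorm_comp_measurePreserving hf hmp]; rfl

end MollifyBounds

section Sobolev

variable {N : ℕ}

theorem IsWeakPartial.fderiv_mollify {f g : EuclideanSpace ℝ (Fin N) → ℝ} {j : Fin N}
    (h : IsWeakPartial Set.univ j f g) (hf : LocallyIntegrable f)
    (b : ContDiffBump (0 : EuclideanSpace ℝ (Fin N))) (x : EuclideanSpace ℝ (Fin N)) :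
    fderiv ℝ (mollify volume b f) x (EuclideanSpace.single j 1) = mollify volume b g x := by
  refine _root_.fderiv_mollify b hf (fun ψ h1 h2 => ?_) x
  simpa using h ψ h1 h2 (Set.subset_univ _)

theorem eLpNorm_fderiv_apply_le {F : EuclideanSpace ℝ (Fin N) → ℝ} (hF : ContDiff ℝ 1 F)
    {p M : ℝ≥0∞} (hp1 : 1 ≤ p)
    (hM : ∀ j, eLpNorm (fun x => fderiv ℝ F x (EuclideanSpace.single j 1)) p volume ≤ M)
    (y : EuclideanSpace ℝ (Fin N)) :
    eLpNorm (fun x => fderiv ℝ F x y) p volume ≤ N * (‖y‖ₑ * M) := by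
  have hy : (fun x => fderiv ℝ F x y)
      = ∑ j : Fin N, fun x => y j * fderiv ℝ F x (EuclideanSpace.single j 1) := by
    ext x
    have : y = ∑ j : Fin N, y j • EuclideanSpace.single j (1 : ℝ) := by
      ext i; simp [Finset.sum_apply, Pi.single_apply]
    conv_lhs => rw [this]
    simp
  rw [hy]
  have hm : ∀ j : Fin N, AEStronglyMeasurable
      (fun x => fderiv ℝ F x (EuclideanSpace.single j 1)) volume := fun j =>
    ((hF.continuous_fderiv one_ne_zero).clm_apply continuous_const).aestronglyMeasurable
  refine (eLpNorm_sum_le (fun j _ => (hm j).const_mul _) hp1).trans ?_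
  refine (Finset.sum_le_sum fun j _ => ?_).trans (le_of_eq (by simp : ∑ j : Fin N, ‖y‖ₑ * M = _))
  refine (eLpNorm_le_mul_eLpNorm_of_ae_le_mul'' (c := ‖y‖ₑ) _ (hm j)
    (.of_forall fun x => ?_)).trans (mul_le_mul_right (hM j) _)
  rw [enorm_mul]
  gcongr
  rw [enorm_le_iff_norm_le]
  exact PiLp.norm_apply_le y j

/-- Translations move a function with gradient in `L^p` at most linearly. -/
theorem eLpNorm_translate_sub_le_of_isWeakPartial {f : EuclideanSpace ℝ (Fin N) → ℝ}
    {g : Fin N → EuclideanSpace ℝ (Fin N) → ℝ} {p M : ℝ≥0∞} (hp1 : 1 ≤ p) (hp : p ≠ ⊤)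
    (hf : MemLp f p volume) (hg : ∀ j, AEStronglyMeasurable (g j) volume)
    (hM : ∀ j, eLpNorm (g j) p volume ≤ M) (hw : ∀ j, IsWeakPartial Set.univ j f (g j))
    (y : EuclideanSpace ℝ (Fin N)) :
    eLpNorm (fun x => f (x - y) - f x) p volume ≤ N * (‖y‖ₑ * M) := by
  have hloc := hf.locallyIntegrable hp1
  -- The estimate holds for the mollifications of `f`, which converge to `f` in `L^p`.
  have hbound : ∀ m, eLpNorm (fun x => f (x - y) - f x) p volume
      ≤ eLpNorm (mollify volume (bumpSeq _ m) f - f) p volume + N * (‖y‖ₑ * M)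
        + eLpNorm (mollify volume (bumpSeq _ m) f - f) p volume := by
    intro m
    set F := mollify volume (bumpSeq (EuclideanSpace ℝ (Fin N)) m) f with hFdef
    have hF : ContDiff ℝ 1 F := contDiff_mollify _ hloc (n := 1)
    have h1 : eLpNorm (fun x => F (x - y) - F x) p volume ≤ N * (‖y‖ₑ * M) := by
      refine eLpNorm_translate_sub_le hF hp1 hp y (eLpNorm_fderiv_apply_le hF hp1 (fun j => ?_) y)
      simp only [hFdef, (hw j).fderiv_mollify hloc]
      exact (eLpNorm_mollify_le _ hp1 hp (hg j)).trans (hM j)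
    have hFm : AEStronglyMeasurable F volume := hF.continuous.aestronglyMeasurable
    have hs : AEStronglyMeasurable (F - f) volume := hFm.sub hf.1
    have hmp := measurePreserving_sub_right (volume : Measure (EuclideanSpace ℝ (Fin N))) y
    have hs' : AEStronglyMeasurable (fun x => (F - f) (x - y)) volume :=
      hs.comp_measurePreserving hmp
    have hFs : AEStronglyMeasurable (fun x => F (x - y) - F x) volume :=
      (hFm.comp_measurePreserving hmp).sub hFm
    have heq : (fun x => f (x - y) - f x)
        = ((F - f) + fun x => F (x - y) - F x) - fun x => (F - f) (x - y) := by
      ext x; simp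
    rw [heq]
    refine (eLpNorm_sub_le (hs.add hFs) hs' hp1).trans ?_
    rw [eLpNorm_comp_sub_right hs y]
    gcongr
    exact (eLpNorm_add_le hs hFs hp1).trans (by gcongr)
  have ht := tendsto_eLpNorm_mollify_sub hp1 hp hf
  have ht2 := (ht.add (tendsto_const_nhds (x := (N : ℝ≥0∞) * (‖y‖ₑ * M)))).add ht
  rw [zero_add, add_zero] at ht2
  exact ge_of_tendsto' ht2 hbound

/-- Functions with gradients bounded in `L^p` are approximated by their mollifications at a rate
depending only on that bound. -/
theorem eLpNorm_mollify_sub_le_of_isWeakPartial {f : EuclideanSpace ℝ (Fin N) → ℝ}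
    {g : Fin N → EuclideanSpace ℝ (Fin N) → ℝ} {p M : ℝ≥0∞} (hp1 : 1 ≤ p) (hp : p ≠ ⊤)
    (hf : MemLp f p volume) (hg : ∀ j, AEStronglyMeasurable (g j) volume)
    (hM : ∀ j, eLpNorm (g j) p volume ≤ M) (hw : ∀ j, IsWeakPartial Set.univ j f (g j))
    (b : ContDiffBump (0 : EuclideanSpace ℝ (Fin N))) :
    eLpNorm (mollify volume b f - f) p volume ≤ N * (ENNReal.ofReal b.rOut * M) := by
  refine eLpNorm_mollify_sub_le b hp1 hp (hf.locallyIntegrable hp1) fun y hy => ?_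
  refine (eLpNorm_translate_sub_le_of_isWeakPartial hp1 hp hf hg hM hw y).trans ?_
  gcongr
  rw [← ofReal_norm]
  exact ENNReal.ofReal_le_ofReal hy.le

end Sobolev

/-! ### Weak continuity of minors -/

section Minors

variable {α : Type*} [MeasurableSpace α] {μ : Measure α} {ι : Type*} [Fintype ι] [LinearOrder ι]
  [Nonempty ι]

theorem memLp_det {p : ℝ≥0∞} (hp1 : 1 ≤ p) (hp : p ≠ ⊤) {g : ι → ι → α → ℝ}
    (hg : ∀ a b, MemLp (g a b) (Fintype.card ι * p) μ) :
    MemLp (fun x => (Matrix.of fun a b => g a b x).det) p μ := by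
  refine ⟨aestronglyMeasurable_det fun a b => (hg a b).1, ?_⟩
  refine (eLpNorm_det_le (fun a b => (hg a b).1) hp1 hp
    (m := fun a => ∑ b, eLpNorm (g a b) (Fintype.card ι * p) μ) (fun a b =>
      Finset.single_le_sum (f := fun b => eLpNorm (g a b) (Fintype.card ι * p) μ)
        (fun _ _ => zero_le) (Finset.mem_univ b))).trans_lt ?_
  refine ENNReal.mul_lt_top (by simp) (ENNReal.prod_lt_top fun a _ => ?_)
  exact ENNReal.sum_lt_top.2 fun b _ => (hg a b).2

/-- Strong `L^k` convergence of the entries passes to `k × k` determinants tested against `φ`. -/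
theorem tendsto_integral_mul_det {φ : α → ℝ} (hφm : AEStronglyMeasurable φ μ) {C : ℝ}
    (hφ : ∀ x, ‖φ x‖ ≤ C) {g : ℕ → ι → ι → α → ℝ} {g' : ι → ι → α → ℝ} {M : ℝ≥0∞} (hM : M ≠ ⊤)
    (hg : ∀ n a b, AEStronglyMeasurable (g n a b) μ)
    (hg' : ∀ a b, AEStronglyMeasurable (g' a b) μ)
    (hMg : ∀ n a b, eLpNorm (g n a b) (Fintype.card ι) μ ≤ M)
    (hMg' : ∀ a b, eLpNorm (g' a b) (Fintype.card ι) μ ≤ M)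
    (h : ∀ a b, Tendsto (fun n => eLpNorm (g n a b - g' a b) (Fintype.card ι) μ) atTop (𝓝 0)) :
    Tendsto (fun n => ∫ x, φ x * (Matrix.of fun a b => g n a b x).det ∂μ) atTop
      (𝓝 (∫ x, φ x * (Matrix.of fun a b => g' a b x).det ∂μ)) := by
  have hint : ∀ q : ι → ι → α → ℝ, (∀ a b, AEStronglyMeasurable (q a b) μ) →
      (∀ a b, eLpNorm (q a b) (Fintype.card ι) μ ≤ M) →
      Integrable (fun x => φ x * (Matrix.of fun a b => q a b x).det) μ := by
    intro q hq hqM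
    have h1 : MemLp (fun x => (Matrix.of fun a b => q a b x).det) 1 μ :=
      memLp_det le_rfl ENNReal.one_ne_top fun a b =>
        ⟨hq a b, by rw [mul_one]; exact (hqM a b).trans_lt hM.lt_top⟩
    exact (memLp_one_iff_integrable.1 h1).bdd_mul hφm (.of_forall hφ)
  set η : ℕ → ℝ≥0∞ := fun n => ∑ a, ∑ b, eLpNorm (g n a b - g' a b) (Fintype.card ι) μ with hηdef
  have hη : Tendsto η atTop (𝓝 0) := by
    have := tendsto_finsetSum Finset.univ fun a _ =>
      tendsto_finsetSum Finset.univ fun b _ => h a b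
    simpa using this
  have hle : ∀ n a b, eLpNorm (g n a b - g' a b) (Fintype.card ι) μ ≤ η n := fun n a b =>
    (Finset.single_le_sum (f := fun b => eLpNorm (g n a b - g' a b) (Fintype.card ι) μ)
      (fun _ _ => zero_le) (Finset.mem_univ b)).trans
    (Finset.single_le_sum (f := fun a => ∑ b, eLpNorm (g n a b - g' a b) (Fintype.card ι) μ)
      (fun _ _ => zero_le) (Finset.mem_univ a))
  refine tendsto_integral_of_L1' _ (hint g' hg' hMg').1
    (.of_forall fun n => hint (g n) (hg n) (hMg n)) ?_
  have hbound : ∀ n, eLpNorm ((fun x => φ x * (Matrix.of fun a b => g n a b x).det)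
        - fun x => φ x * (Matrix.of fun a b => g' a b x).det) 1 μ
      ≤ ENNReal.ofReal C * (Fintype.card ι * ((Fintype.card ι).factorial *
        (η n * M ^ (Fintype.card ι - 1)))) := by
    intro n
    have h1 := eLpNorm_det_sub_le (p := 1) (hg n) hg' le_rfl ENNReal.one_ne_top
      (M := M) (η := η n) (fun a b => by rw [mul_one]; exact hMg n a b)
      (fun a b => by rw [mul_one]; exact hMg' a b) (fun a b => by rw [mul_one]; exact hle n a b)
    refine (eLpNorm_le_mul_eLpNorm_of_ae_le_mul'' (c := ENNReal.ofReal C) _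
      ((aestronglyMeasurable_det (hg n)).sub (aestronglyMeasurable_det hg'))
      (.of_forall fun x => ?_)).trans (mul_le_mul_right h1 _)
    rw [Pi.sub_apply, ← mul_sub, enorm_mul, ← ofReal_norm (φ x)]
    exact mul_le_mul_left (ENNReal.ofReal_le_ofReal (hφ x)) _
  refine tendsto_of_tendsto_of_tendsto_of_le_of_le tendsto_const_nhds ?_ (fun _ => zero_le) hbound
  have h0 : Tendsto (fun n => η n * M ^ (Fintype.card ι - 1)) atTop (𝓝 0) := by
    simpa using ENNReal.Tendsto.mul_const hη (Or.inr (by finiteness))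
  have h1 := ENNReal.Tendsto.const_mul (a := ((Fintype.card ι).factorial : ℝ≥0∞)) h0
    (Or.inr (by simp))
  have h2 := ENNReal.Tendsto.const_mul (a := (Fintype.card ι : ℝ≥0∞)) h1 (Or.inr (by simp))
  have h3 := ENNReal.Tendsto.const_mul (a := ENNReal.ofReal C) h2 (Or.inr (by simp))
  simpa using h3

end Minors

section Compactness

variable {N : ℕ} {ι : Type*} [Fintype ι] [LinearOrder ι] [Nonempty ι]

theorem one_le_natCast_card {κ : Type*} [Fintype κ] [Nonempty κ] : (1 : ℝ≥0∞) ≤ Fintype.card κ := by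
  exact_mod_cast Fintype.card_pos

/-- Mollification changes the integral of a minor of the gradient by at most a constant times the
radius of the mollifier, and the constant depends on the functions only through the `L^k` bound of
their gradients. -/
theorem enorm_integral_minor_sub_mollify_le (e : ι → Fin N)
    {f : ι → EuclideanSpace ℝ (Fin N) → ℝ} {g : ι → Fin N → EuclideanSpace ℝ (Fin N) → ℝ}
    {M : ℝ≥0∞} (hMtop : M ≠ ⊤)
    (hf : ∀ a, MemLp (f a) (Fintype.card ι) volume)
    (hg : ∀ a j, AEStronglyMeasurable (g a j) volume)
    (hM : ∀ a j, eLpNorm (g a j) (Fintype.card ι) volume ≤ M)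
    (hw : ∀ a j, IsWeakPartial Set.univ j (f a) (g a j))
    {φ : EuclideanSpace ℝ (Fin N) → ℝ} (hφ : ContDiff ℝ 1 φ) (hc : HasCompactSupport φ)
    {L : ℝ≥0∞} (hLtop : L ≠ ⊤) (hL : ∀ j x, ‖fderiv ℝ φ x (EuclideanSpace.single j 1)‖ₑ ≤ L)
    (b : ContDiffBump (0 : EuclideanSpace ℝ (Fin N))) :
    ‖(∫ x, φ x * (Matrix.of fun a c => g a (e c) x).det)
        - ∫ x, φ x * (Matrix.of fun a c => mollify volume b (g a (e c)) x).det‖ₑ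
      ≤ Fintype.card ι * ((Fintype.card ι).factorial *
        (L * (N * (ENNReal.ofReal b.rOut * M)) * M ^ (Fintype.card ι - 1))) := by
  have hp1 : (1 : ℝ≥0∞) ≤ Fintype.card ι := one_le_natCast_card
  have hp : (Fintype.card ι : ℝ≥0∞) ≠ ⊤ := by simp
  have hloc := fun a => (hf a).locallyIntegrable hp1
  have hsm : ∀ (b : ContDiffBump (0 : EuclideanSpace ℝ (Fin N))) a,
      ContDiff ℝ 2 (mollify volume b (f a)) := fun b a => contDiff_mollify b (hloc a) (n := 2)
  have hmM : ∀ (b : ContDiffBump (0 : EuclideanSpace ℝ (Fin N))) a j,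
      eLpNorm (mollify volume b (g a j)) (Fintype.card ι) volume ≤ M := fun b a j =>
    (eLpNorm_mollify_le b hp1 hp (hg a j)).trans (hM a j)
  have hgm : ∀ a j, MemLp (g a j) (Fintype.card ι) volume := fun a j =>
    ⟨hg a j, (hM a j).trans_lt hMtop.lt_top⟩
  have hmm : ∀ (b : ContDiffBump (0 : EuclideanSpace ℝ (Fin N))) a j,
      AEStronglyMeasurable (mollify volume b (g a j)) volume := fun b a j =>
    (contDiff_mollify b ((hgm a j).locallyIntegrable hp1)
      (n := 0)).continuous.aestronglyMeasurable
  obtain ⟨C, hC⟩ := hc.exists_bound_of_continuous hφ.continuous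
  -- The smooth estimate compares scale `b` with scale `1 / (m + 1)`; then `m` tends to infinity.
  set η : ℕ → ℝ≥0∞ := fun m => ∑ a, eLpNorm (mollify volume (bumpSeq _ m) (f a) - f a)
    (Fintype.card ι) volume with hηdef
  have hη : Tendsto η atTop (𝓝 0) := by
    have := tendsto_finsetSum Finset.univ fun a _ =>
      tendsto_eLpNorm_mollify_sub (μ := volume) hp1 hp (hf a)
    simpa using this
  have h1 : Tendsto (fun m => ∫ x, φ x * (Matrix.of fun a c =>
        mollify volume (bumpSeq _ m) (g a (e c)) x).det) atTop
      (𝓝 (∫ x, φ x * (Matrix.of fun a c => g a (e c) x).det)) :=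
    tendsto_integral_mul_det (g := fun m a c => mollify volume (bumpSeq _ m) (g a (e c)))
      (g' := fun a c => g a (e c))
      hφ.continuous.aestronglyMeasurable hC hMtop (fun m a c => hmm _ a _) (fun a c => hg a _)
      (fun m a c => hmM _ a _) (fun a c => hM a _)
      (fun a c => tendsto_eLpNorm_mollify_sub hp1 hp (hgm a _))
  have h2 := (h1.sub_const (∫ x, φ x * (Matrix.of fun a c =>
    mollify volume b (g a (e c)) x).det)).enorm
  have hbound : ∀ m, ‖(∫ x, φ x * (Matrix.of fun a c =>
        mollify volume (bumpSeq _ m) (g a (e c)) x).det)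
        - ∫ x, φ x * (Matrix.of fun a c => mollify volume b (g a (e c)) x).det‖ₑ
      ≤ Fintype.card ι * ((Fintype.card ι).factorial *
        (L * (η m + N * (ENNReal.ofReal b.rOut * M)) * M ^ (Fintype.card ι - 1))) := by
    intro m
    have h3 := enorm_integral_mul_det_fderiv_sub_le (μ := volume) (hsm (bumpSeq _ m)) (hsm b) hφ hc
      (fun c => EuclideanSpace.single (e c) (1 : ℝ)) (L := L)
      (η := η m + N * (ENNReal.ofReal b.rOut * M)) (M := M) (fun c x => hL (e c) x) ?_ ?_ ?_
    · simpa only [(hw _ _).fderiv_mollify (hloc _)] using h3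
    · intro a
      have heq : mollify volume (bumpSeq _ m) (f a) - mollify volume b (f a)
          = (mollify volume (bumpSeq _ m) (f a) - f a) - (mollify volume b (f a) - f a) := by
        abel
      rw [heq]
      refine (eLpNorm_sub_le ((hsm _ a).continuous.aestronglyMeasurable.sub (hf a).1)
        ((hsm _ a).continuous.aestronglyMeasurable.sub (hf a).1) hp1).trans ?_
      refine add_le_add ?_ (eLpNorm_mollify_sub_le_of_isWeakPartial hp1 hp (hf a) (hg a) (hM a)
        (hw a) b)
      exact Finset.single_le_sum (f := fun a => eLpNorm (mollify volume (bumpSeq _ m) (f a) - f a)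
        (Fintype.card ι) volume) (fun _ _ => zero_le) (Finset.mem_univ a)
    · intro a c
      simpa only [(hw _ _).fderiv_mollify (hloc _)] using hmM _ a _
    · intro a c
      simpa only [(hw _ _).fderiv_mollify (hloc _)] using hmM _ a _
  refine le_of_tendsto_of_tendsto' h2 ?_ hbound
  have h4 : Tendsto (fun m => η m + N * (ENNReal.ofReal b.rOut * M)) atTop
      (𝓝 (N * (ENNReal.ofReal b.rOut * M))) := by
    simpa using hη.add_const (N * (ENNReal.ofReal b.rOut * M))
  have h5 := ENNReal.Tendsto.const_mul (a := L) h4 (Or.inr hLtop)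
  have h6 := ENNReal.Tendsto.mul_const (b := M ^ (Fintype.card ι - 1)) h5
    (Or.inr (by finiteness))
  exact ENNReal.Tendsto.const_mul (ENNReal.Tendsto.const_mul h6 (Or.inr (by simp)))
    (Or.inr (by simp))

/-- At a fixed mollification scale weak convergence of the gradients becomes pointwise, with a
uniform bound. -/
theorem tendsto_integral_mollify_minor (e : ι → Fin N)
    {g : ℕ → ι → Fin N → EuclideanSpace ℝ (Fin N) → ℝ}
    {g' : ι → Fin N → EuclideanSpace ℝ (Fin N) → ℝ} {M : ℝ≥0∞} (hMtop : M ≠ ⊤)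
    (hg : ∀ n a j, AEStronglyMeasurable (g n a j) volume)
    (hM : ∀ n a j, eLpNorm (g n a j) (Fintype.card ι) volume ≤ M)
    (hconv : ∀ a j (ψ : EuclideanSpace ℝ (Fin N) → ℝ), ContDiff ℝ ∞ ψ → HasCompactSupport ψ →
      Tendsto (fun n => ∫ x, g n a j x * ψ x) atTop (𝓝 (∫ x, g' a j x * ψ x)))
    {φ : EuclideanSpace ℝ (Fin N) → ℝ} (hφ : Continuous φ) (hc : HasCompactSupport φ)
    (b : ContDiffBump (0 : EuclideanSpace ℝ (Fin N))) :
    Tendsto (fun n => ∫ x, φ x * (Matrix.of fun a c => mollify volume b (g n a (e c)) x).det) atTop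
      (𝓝 (∫ x, φ x * (Matrix.of fun a c => mollify volume b (g' a (e c)) x).det)) := by
  have hp1 : (1 : ℝ≥0∞) ≤ Fintype.card ι := one_le_natCast_card
  have hp : (Fintype.card ι : ℝ≥0∞) ≠ ⊤ := by simp
  obtain ⟨R, hR, hRb⟩ := exists_enorm_mollify_le (μ := volume) b hp1 hp
  have hbd : ∀ n a j x, |mollify volume b (g n a j) x| ≤ (R * M).toReal := by
    intro n a j x
    have h := (hRb _ (hg n a j) x).trans (mul_le_mul_right (hM n a j) R)
    rw [← ofReal_norm] at h
    exact (ENNReal.ofReal_le_iff_le_toReal (by finiteness)).1 h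
  have hgl : ∀ n a j, LocallyIntegrable (g n a j) := fun n a j =>
    MemLp.locallyIntegrable ⟨hg n a j, (hM n a j).trans_lt hMtop.lt_top⟩ hp1
  have hpt : ∀ a j x, Tendsto (fun n => mollify volume b (g n a j) x) atTop
      (𝓝 (mollify volume b (g' a j) x)) := by
    intro a j x
    simp only [mollify_apply]
    exact hconv a j (fun t => b.normed volume (x - t))
      ((b.contDiff_normed (n := ⊤)).comp (contDiff_const.sub contDiff_id))
      ((b.hasCompactSupport_normed (μ := volume)).comp_homeomorph (Homeomorph.subLeft x))
  refine tendsto_integral_of_dominated_convergence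
    (fun x => |φ x| * ((Fintype.card ι).factorial • (R * M).toReal ^ Fintype.card ι)) ?_ ?_ ?_ ?_
  · intro n
    exact hφ.aestronglyMeasurable.mul (aestronglyMeasurable_det fun a c =>
      (contDiff_mollify b (hgl n a _) (n := 0)).continuous.aestronglyMeasurable)
  · exact (hφ.abs.integrable_of_hasCompactSupport hc.abs).mul_const _
  · intro n
    refine .of_forall fun x => ?_
    rw [norm_mul, Real.norm_eq_abs]
    refine mul_le_mul_of_nonneg_left ?_ (abs_nonneg _)
    have := Matrix.det_le (A := Matrix.of fun a c => mollify volume b (g n a (e c)) x)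
      (abv := AbsoluteValue.abs) (x := (R * M).toReal) (fun a c => hbd n a (e c) x)
    simpa using this
  · refine .of_forall fun x => ?_
    refine Tendsto.const_mul _ ?_
    simp only [det_of_eq_sum_perm]
    exact tendsto_finsetSum _ fun σ _ => Tendsto.const_mul _
      (tendsto_finsetProd _ fun a _ => hpt a _ x)

/-- **Weak continuity of minors.** If the gradients of a sequence of `k`-tuples of functions are
bounded in `L^k` and converge against test functions, then their `k × k` minors converge against
test functions as well: the minors of the mollified gradients converge at every fixed scale, and
they approximate the minors uniformly along the sequence. -/
theorem tendsto_integral_minor (e : ι → Fin N)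
    {f : ℕ → ι → EuclideanSpace ℝ (Fin N) → ℝ}
    {g : ℕ → ι → Fin N → EuclideanSpace ℝ (Fin N) → ℝ}
    {g' : ι → Fin N → EuclideanSpace ℝ (Fin N) → ℝ} {M : ℝ≥0∞} (hMtop : M ≠ ⊤)
    (hf : ∀ n a, MemLp (f n a) (Fintype.card ι) volume)
    (hg : ∀ n a j, AEStronglyMeasurable (g n a j) volume)
    (hM : ∀ n a j, eLpNorm (g n a j) (Fintype.card ι) volume ≤ M)
    (hg' : ∀ a j, AEStronglyMeasurable (g' a j) volume)
    (hM' : ∀ a j, eLpNorm (g' a j) (Fintype.card ι) volume ≤ M)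
    (hw : ∀ n a j, IsWeakPartial Set.univ j (f n a) (g n a j))
    (hconv : ∀ a j (ψ : EuclideanSpace ℝ (Fin N) → ℝ), ContDiff ℝ ∞ ψ → HasCompactSupport ψ →
      Tendsto (fun n => ∫ x, g n a j x * ψ x) atTop (𝓝 (∫ x, g' a j x * ψ x)))
    {φ : EuclideanSpace ℝ (Fin N) → ℝ} (hφ : ContDiff ℝ 1 φ) (hc : HasCompactSupport φ) :
    Tendsto (fun n => ∫ x, φ x * (Matrix.of fun a c => g n a (e c) x).det) atTop
      (𝓝 (∫ x, φ x * (Matrix.of fun a c => g' a (e c) x).det)) := by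
  have hp1 : (1 : ℝ≥0∞) ≤ Fintype.card ι := one_le_natCast_card
  have hp : (Fintype.card ι : ℝ≥0∞) ≠ ⊤ := by simp
  obtain ⟨C, hC⟩ := hc.exists_bound_of_continuous hφ.continuous
  obtain ⟨D, hD⟩ := (hc.fderiv (𝕜 := ℝ)).exists_bound_of_continuous
    (hφ.continuous_fderiv one_ne_zero)
  have hL : ∀ (j : Fin N) x, ‖fderiv ℝ φ x (EuclideanSpace.single j 1)‖ₑ ≤ ENNReal.ofReal D := by
    intro j x
    rw [← ofReal_norm]
    refine ENNReal.ofReal_le_ofReal (((fderiv ℝ φ x).le_opNorm _).trans ?_)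
    simpa using hD x
  set K : ℕ → ℝ≥0∞ := fun m => Fintype.card ι * ((Fintype.card ι).factorial *
    (ENNReal.ofReal D * (N * (ENNReal.ofReal (1 / ((m : ℝ) + 1)) * M)) *
      M ^ (Fintype.card ι - 1))) with hK
  have hKlim : Tendsto K atTop (𝓝 0) := by
    have h0 : Tendsto (fun m : ℕ => ENNReal.ofReal (1 / ((m : ℝ) + 1))) atTop (𝓝 0) := by
      simpa using ENNReal.tendsto_ofReal (tendsto_one_div_add_atTop_nhds_zero_nat (𝕜 := ℝ))
    have h1 := ENNReal.Tendsto.mul_const (b := M) h0 (Or.inr hMtop)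
    have h2 := ENNReal.Tendsto.const_mul (a := (N : ℝ≥0∞)) h1 (Or.inr (by simp))
    have h3 := ENNReal.Tendsto.const_mul (a := ENNReal.ofReal D) h2 (Or.inr (by simp))
    have h4 := ENNReal.Tendsto.mul_const (b := M ^ (Fintype.card ι - 1)) h3
      (Or.inr (by finiteness))
    have h5 := ENNReal.Tendsto.const_mul (a := ((Fintype.card ι).factorial : ℝ≥0∞)) h4
      (Or.inr (by simp))
    have h6 := ENNReal.Tendsto.const_mul (a := (Fintype.card ι : ℝ≥0∞)) h5 (Or.inr (by simp))
    simpa [hK] using h6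
  have hgm' : ∀ a j, MemLp (g' a j) (Fintype.card ι) volume := fun a j =>
    ⟨hg' a j, (hM' a j).trans_lt hMtop.lt_top⟩
  have hunif : TendstoUniformly (fun m n => ∫ x, φ x * (Matrix.of fun a c =>
        mollify volume (bumpSeq _ m) (g n a (e c)) x).det)
      (fun n => ∫ x, φ x * (Matrix.of fun a c => g n a (e c) x).det) atTop := by
    rw [EMetric.tendstoUniformly_iff]
    intro ε hε
    filter_upwards [hKlim.eventually_lt_const hε] with m hm n
    rw [edist_eq_enorm_sub]
    exact (enorm_integral_minor_sub_mollify_le e hMtop (hf n) (hg n) (hM n) (hw n) hφ hc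
      ENNReal.ofReal_ne_top hL (bumpSeq _ m)).trans_lt hm
  refine hunif.tendsto_of_eventually_tendsto (.of_forall fun m =>
    tendsto_integral_mollify_minor e hMtop hg hM hconv hφ.continuous hc (bumpSeq _ m)) ?_
  exact tendsto_integral_mul_det (g := fun m a c => mollify volume (bumpSeq _ m) (g' a (e c)))
      (g' := fun a c => g' a (e c))
      hφ.continuous.aestronglyMeasurable hC hMtop (fun m a c => (contDiff_mollify _
        ((hgm' a _).locallyIntegrable hp1) (n := 0)).continuous.aestronglyMeasurable)
      (fun a c => hg' a _)
      (fun m a c => (eLpNorm_mollify_le _ hp1 hp (hg' a _)).trans (hM' a _)) (fun a c => hM' a _)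
      (fun a c => tendsto_eLpNorm_mollify_sub hp1 hp (hgm' a _))

end Compactness

/-! ### Weak convergence in `L^p` -/

section WeakConvergence

variable {X : Type*} [NormedAddCommGroup X] [NormedSpace ℝ X]

theorem tendstoWeakly_iff {u : ℕ → X} {v : X} :
    TendstoWeakly u v ↔ ∀ ℓ : X →L[ℝ] ℝ, Tendsto (fun n => ℓ (u n)) atTop (𝓝 (ℓ v)) := by
  have hind : Topology.IsInducing
      fun (x : WeakSpace ℝ X) y => (topDualPairing ℝ X).flip x y := ⟨rfl⟩
  rw [TendstoWeakly, hind.tendsto_nhds_iff, tendsto_pi_nhds]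
  rfl

/-- Weakly convergent sequences are bounded, by the Banach-Steinhaus theorem in the bidual. -/
theorem TendstoWeakly.exists_norm_le {u : ℕ → X} {v : X} (h : TendstoWeakly u v) :
    ∃ C, ∀ n, ‖u n‖ ≤ C := by
  rw [tendstoWeakly_iff] at h
  obtain ⟨C, hC⟩ := banach_steinhaus (g := fun n => NormedSpace.inclusionInDoubleDual ℝ X (u n))
    fun ℓ => by
      obtain ⟨C, hC⟩ := (h ℓ).norm.bddAbove_range
      exact ⟨C, fun n => hC ⟨n, rfl⟩⟩
  refine ⟨C, fun n => ?_⟩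
  have h1 := (NormedSpace.inclusionInDoubleDualLi ℝ (E := X)).norm_map (u n)
  rw [← h1]
  exact hC n

end WeakConvergence

section Cutoff

variable {E : Type*} [NormedAddCommGroup E] [NormedSpace ℝ E] [FiniteDimensional ℝ E]

theorem exists_contDiff_cutoff {K U : Set E} (hK : IsCompact K) (hU : IsOpen U) (hKU : K ⊆ U) :
    ∃ χ : E → ℝ, ContDiff ℝ ∞ χ ∧ HasCompactSupport χ ∧ tsupport χ ⊆ U ∧
      (∀ x ∈ K, χ =ᶠ[𝓝 x] 1) ∧ ∀ x, χ x ∈ Set.Icc 0 1 := by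
  obtain ⟨K', hK', h1, h2⟩ := exists_compact_between hK hU hKU
  obtain ⟨χ, hχ1, hχ0, hχ⟩ := exists_contMDiffMap_one_nhds_of_subset_interior
    (modelWithCornersSelf ℝ E) hK.isClosed h1 (n := ⊤)
  have hs : tsupport χ ⊆ K' := closure_minimal (fun x hx => by
    by_contra h; exact hx (hχ0 x h)) hK'.isClosed
  exact ⟨χ, χ.contMDiff.contDiff, hK'.of_isClosed_subset (isClosed_tsupport _) hs, hs.trans h2,
    fun x hx => eventually_nhdsSet_iff_forall.1 hχ1 x hx, hχ⟩

variable [MeasurableSpace E] [BorelSpace E] {μ : Measure E} [IsFiniteMeasureOnCompacts μ]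
  [μ.InnerRegularCompactLTTop]

/-- Test functions supported in an open set of finite measure are dense in its `L^q` space: an
approximating function with compact support in the whole space is cut off near the boundary. -/
theorem exists_contDiff_tsupport_subset_eLpNorm_sub_le {Ω : Set E} (hΩ : IsOpen Ω)
    (hΩf : μ Ω ≠ ⊤) {q : ℝ≥0∞} (hq1 : 1 ≤ q) (hq : q ≠ ⊤) {g : E → ℝ}
    (hg : MemLp g q (μ.restrict Ω)) {ε : ℝ} (hε : 0 < ε) :
    ∃ φ : E → ℝ, ContDiff ℝ ∞ φ ∧ HasCompactSupport φ ∧ tsupport φ ⊆ Ω ∧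
      eLpNorm (g - φ) q (μ.restrict Ω) ≤ ENNReal.ofReal ε := by
  have hq0 : q ≠ 0 := (zero_lt_one.trans_le hq1).ne'
  have hqr : 0 < q.toReal := ENNReal.toReal_pos hq0 hq
  obtain ⟨φ, hφc, hφ, hφε⟩ := hg.exist_eLpNorm_sub_le hq hq1 (half_pos hε)
  obtain ⟨C, hC⟩ := hφc.exists_bound_of_continuous hφ.continuous
  -- The cutoff only changes `φ` on a set of small measure.
  obtain ⟨δ, hδ, hδε⟩ : ∃ δ : ℝ≥0∞, 0 < δ ∧
      δ ^ q.toReal⁻¹ * ENNReal.ofReal C ≤ ENNReal.ofReal (ε / 2) := by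
    have h : Tendsto (fun δ : ℝ≥0∞ => δ ^ q.toReal⁻¹ * ENNReal.ofReal C) (𝓝[>] 0) (𝓝 0) := by
      have h1 : Tendsto (fun δ : ℝ≥0∞ => δ ^ q.toReal⁻¹) (𝓝[>] 0) (𝓝 0) := by
        have := (ENNReal.continuous_rpow_const (y := q.toReal⁻¹)).tendsto 0
        rw [ENNReal.zero_rpow_of_pos (by positivity)] at this
        exact this.mono_left nhdsWithin_le_nhds
      simpa using ENNReal.Tendsto.mul_const (b := ENNReal.ofReal C) h1 (Or.inr (by simp))
    have h2 := (h.eventually (ge_mem_nhds (ENNReal.ofReal_pos.2 (half_pos hε)))).and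
      self_mem_nhdsWithin
    obtain ⟨δ, h3, h4⟩ := h2.exists
    exact ⟨δ, h4, h3⟩
  obtain ⟨K, hKΩ, hK, hKc, hμK⟩ :=
    hΩ.measurableSet.exists_isCompact_isClosed_lt_add hΩf hδ.ne'
  obtain ⟨χ, hχ, hχc, hχΩ, hχK, hχ01⟩ := exists_contDiff_cutoff hK hΩ hKΩ
  have hdiff : μ.restrict Ω Kᶜ ≤ δ := by
    rw [Measure.restrict_apply hKc.measurableSet.compl, Set.inter_comm, ← Set.sdiff_eq,
      measure_sdiff hKΩ hKc.measurableSet.nullMeasurableSet (hK.measure_lt_top).ne]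
    exact tsub_le_iff_left.2 hμK.le
  refine ⟨fun x => χ x * φ x, hχ.mul hφ, hφc.mul_left, (tsupport_mul_subset_left).trans hχΩ, ?_⟩
  have hle : eLpNorm (φ - fun x => χ x * φ x) q (μ.restrict Ω) ≤ ENNReal.ofReal (ε / 2) := by
    have heq : eLpNorm (φ - fun x => χ x * φ x) q (μ.restrict Ω)
        = eLpNorm (φ - fun x => χ x * φ x) q ((μ.restrict Ω).restrict Kᶜ) := by
      rw [← eLpNorm_indicator_eq_eLpNorm_restrict hKc.measurableSet.compl]
      have hsupp : Function.support (φ - fun x => χ x * φ x) ⊆ Kᶜ := by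
        intro x hx hxK
        have : χ x = 1 := (hχK x hxK).self_of_nhds
        exact hx (by simp [this])
      rw [Set.indicator_eq_self.2 hsupp]
    rw [heq]
    refine (eLpNorm_le_of_ae_bound (C := C) (.of_forall fun x => ?_)).trans ?_
    · have : (φ - fun x => χ x * φ x) x = (1 - χ x) * φ x := by simp; ring
      rw [this, norm_mul, Real.norm_eq_abs, abs_of_nonneg (by linarith [(hχ01 x).2])]
      exact (mul_le_of_le_one_left (norm_nonneg _) (by linarith [(hχ01 x).1])).trans (hC x)
    · rw [Measure.restrict_apply_univ]
      refine le_trans ?_ hδε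
      gcongr
  have heq : g - (fun x => χ x * φ x) = (g - φ) + (φ - fun x => χ x * φ x) := by abel
  rw [heq, ← add_halves ε, ENNReal.ofReal_add (half_pos hε).le (half_pos hε).le]
  refine (eLpNorm_add_le (hg.1.sub hφ.continuous.aestronglyMeasurable)
    (hφ.continuous.sub (hχ.continuous.mul hφ.continuous)).aestronglyMeasurable hq1).trans ?_
  exact add_le_add hφε hle

end Cutoff

section Duality

variable {α : Type*} [MeasurableSpace α] {ν : Measure α} [IsFiniteMeasure ν]

/-- The inclusion of `L^2` into `L^p` for `p ≤ 2` over a finite measure. -/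
noncomputable def inclusionL2 (ν : Measure α) [IsFiniteMeasure ν] (p : ℝ≥0∞) [Fact (1 ≤ p)]
    (hp2 : p ≤ 2) : Lp ℝ 2 ν →L[ℝ] Lp ℝ p ν :=
  LinearMap.mkContinuous
    { toFun := fun f => ((Lp.memLp f).mono_exponent hp2).toLp
      map_add' := fun f g => by
        rw [← MemLp.toLp_add]
        exact MemLp.toLp_congr _ _ (Lp.coeFn_add f g)
      map_smul' := fun c f => by
        rw [RingHom.id_apply, ← MemLp.toLp_const_smul]
        exact MemLp.toLp_congr _ _ (Lp.coeFn_smul c f) }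
    (ν Set.univ ^ (1 / p.toReal - 1 / (2 : ℝ≥0∞).toReal)).toReal
    fun f => by
      have hp0 : p ≠ 0 := (zero_lt_one.trans_le (Fact.out : 1 ≤ p)).ne'
      have hpt : p ≠ ⊤ := ne_top_of_le_ne_top (by simp) hp2
      have hexp : 0 ≤ 1 / p.toReal - 1 / (2 : ℝ≥0∞).toReal := by
        have h1 : 0 < p.toReal := ENNReal.toReal_pos hp0 hpt
        have h2 : p.toReal ≤ (2 : ℝ≥0∞).toReal := ENNReal.toReal_mono (by simp) hp2
        exact sub_nonneg.2 (one_div_le_one_div_of_le h1 h2)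
      have h := eLpNorm_le_eLpNorm_mul_rpow_measure_univ hp2 (Lp.memLp f).1
      change ‖((Lp.memLp f).mono_exponent hp2).toLp‖ ≤ _
      rw [Lp.norm_toLp, Lp.norm_def, mul_comm, ← ENNReal.toReal_mul]
      refine ENNReal.toReal_mono (ENNReal.mul_ne_top (Lp.memLp f).2.ne ?_) h
      exact ENNReal.rpow_ne_top_of_nonneg hexp (measure_ne_top _ _)

/-- A converse of Hölder's inequality: `g` is tested against the truncations of `|g|^(q-2) g`,
for which Hölder's inequality is an equality. -/
theorem memLp_of_forall_integral_mul_le {p q : ℝ} (hpq : p.HolderConjugate q) {g : α → ℝ}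
    (hg : AEStronglyMeasurable g ν) {C : ℝ} (hC : 0 ≤ C)
    (h : ∀ f : α → ℝ, MemLp f ⊤ ν →
      |∫ x, f x * g x ∂ν| ≤ C * (eLpNorm f (ENNReal.ofReal p) ν).toReal) :
    MemLp g (ENNReal.ofReal q) ν := by
  have hq0 : ENNReal.ofReal q ≠ 0 := by simpa using hpq.symm.pos
  have hp0 : ENNReal.ofReal p ≠ 0 := by simpa using hpq.pos
  -- A bound for the truncations of `g`.
  have hbound : ∀ R : ℕ, eLpNorm (fun x => if |g x| ≤ R then g x else 0) (ENNReal.ofReal q) ν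
      ≤ ENNReal.ofReal C := by
    intro R
    set r : α → ℝ := fun x => if |g x| ≤ R then g x else 0 with hr
    have hrm : AEStronglyMeasurable r ν := by
      have hmeas : Measurable fun t : ℝ => if |t| ≤ R then t else 0 :=
        Measurable.ite (measurableSet_le measurable_norm measurable_const) measurable_id
          measurable_const
      exact (hmeas.comp_aemeasurable hg.aemeasurable).aestronglyMeasurable
    have hrR : ∀ x, |r x| ≤ R := by
      intro x
      simp only [hr]
      split_ifs with hx
      · exact hx
      · simp
    have hr_top : MemLp r ⊤ ν := memLp_top_of_bound hrm R (.of_forall hrR)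
    have hrq : MemLp r (ENNReal.ofReal q) ν := hr_top.mono_exponent le_top
    set f : α → ℝ := fun x => |r x| ^ (q - 2) * r x with hf
    have hfabs : ∀ x, |f x| = |r x| ^ (q - 1) := by
      intro x
      rw [hf]
      by_cases h0 : r x = 0
      · simp [h0, Real.zero_rpow (sub_pos.2 hpq.symm.lt).ne']
      · have h1 : 0 < |r x| := abs_pos.2 h0
        rw [abs_mul, abs_of_nonneg (Real.rpow_nonneg h1.le _)]
        conv_lhs => rw [← Real.rpow_one |r x|, ← Real.rpow_mul h1.le, one_mul]
        rw [← Real.rpow_add h1]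
        ring_nf
    have hfm : AEStronglyMeasurable f ν :=
      ((hrm.aemeasurable.abs.pow_const _).mul hrm.aemeasurable).aestronglyMeasurable
    have hf_top : MemLp f ⊤ ν := by
      refine memLp_top_of_bound hfm ((R : ℝ) ^ (q - 1)) (.of_forall fun x => ?_)
      rw [Real.norm_eq_abs, hfabs]
      exact Real.rpow_le_rpow (abs_nonneg _) (hrR x) (sub_pos.2 hpq.symm.lt).le
    have hfp : MemLp f (ENNReal.ofReal p) ν := hf_top.mono_exponent le_top
    set a : ℝ := ∫ x, |r x| ^ q ∂ν with ha
    have ha0 : 0 ≤ a := integral_nonneg fun x => Real.rpow_nonneg (abs_nonneg _) _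
    have h1 : ∫ x, f x * g x ∂ν = a := by
      refine integral_congr_ae (.of_forall fun x => ?_)
      simp only [hf]
      by_cases h0 : r x = 0
      · simp [h0, Real.zero_rpow hpq.symm.pos.ne']
      · have hgr : g x = r x := by
          simp only [hr] at h0 ⊢
          split_ifs at h0 ⊢ with hx
          · rfl
          · exact absurd rfl h0
        have h1 : 0 < |r x| := abs_pos.2 h0
        rw [hgr, mul_assoc, ← abs_mul_abs_self (r x)]
        nth_rewrite 2 [← Real.rpow_one |r x|]
        nth_rewrite 3 [← Real.rpow_one |r x|]
        rw [← Real.rpow_add h1, ← Real.rpow_add h1]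
        ring_nf
    have h2 : eLpNorm f (ENNReal.ofReal p) ν = ENNReal.ofReal (a ^ p⁻¹) := by
      rw [hfp.eLpNorm_eq_integral_rpow_norm hp0 ENNReal.ofReal_ne_top,
        ENNReal.toReal_ofReal hpq.nonneg]
      congr 3
      ext x
      rw [Real.norm_eq_abs, hfabs, ← Real.rpow_mul (abs_nonneg _), hpq.symm.sub_one_mul_conj]
    have h3 := h f hf_top
    rw [h1, h2, ENNReal.toReal_ofReal (by positivity), abs_of_nonneg ha0] at h3
    rw [hrq.eLpNorm_eq_integral_rpow_norm hq0 ENNReal.ofReal_ne_top,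
      ENNReal.toReal_ofReal hpq.symm.nonneg]
    refine ENNReal.ofReal_le_ofReal ?_
    change a ^ q⁻¹ ≤ C
    rcases ha0.eq_or_lt with ha1 | ha1
    · rw [← ha1, Real.zero_rpow (inv_pos.2 hpq.symm.pos).ne']
      exact hC
    · have h5 : a = a ^ q⁻¹ * a ^ p⁻¹ := by
        rw [← Real.rpow_add ha1, add_comm, hpq.inv_add_inv_eq_one, Real.rpow_one]
      have h6 : 0 < a ^ p⁻¹ := Real.rpow_pos_of_pos ha1 _
      rw [h5] at h3
      exact le_of_mul_le_mul_right (by simpa only [← h5] using h3) h6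
  refine ⟨hg, lt_of_le_of_lt ?_ (ENNReal.ofReal_lt_top (r := C))⟩
  refine (Lp.eLpNorm_lim_le_liminf_eLpNorm
    (f := fun (R : ℕ) x => if |g x| ≤ R then g x else 0) (fun R => ?_) g
    (.of_forall fun x => ?_)).trans ?_
  · have hmeas : Measurable fun t : ℝ => if |t| ≤ R then t else 0 :=
      Measurable.ite (measurableSet_le measurable_norm measurable_const) measurable_id
        measurable_const
    exact (hmeas.comp_aemeasurable hg.aemeasurable).aestronglyMeasurable
  · refine tendsto_const_nhds.congr' ?_
    filter_upwards [eventually_ge_atTop ⌈|g x|⌉₊] with R hR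
    rw [if_pos ((Nat.le_ceil _).trans (by exact_mod_cast hR))]
  · refine (liminf_le_liminf (.of_forall hbound)).trans (le_of_eq ?_)
    simp

/-- **Riesz representation** of the functionals on `L^p`, `1 < p ≤ 2`, over a finite measure: the
restriction to `L^2` is represented by a function of `L^2`, which is then in the dual space. -/
theorem exists_memLp_forall_eq_integral {p q : ℝ} (hpq : p.HolderConjugate q) (hp2 : p ≤ 2)
    [Fact (1 ≤ ENNReal.ofReal p)] (ℓ : Lp ℝ (ENNReal.ofReal p) ν →L[ℝ] ℝ) :
    ∃ g : α → ℝ, MemLp g (ENNReal.ofReal q) ν ∧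
      ∀ f : Lp ℝ (ENNReal.ofReal p) ν, ℓ f = ∫ x, f x * g x ∂ν := by
  have hp2' : ENNReal.ofReal p ≤ 2 := by
    rw [← ENNReal.ofReal_ofNat]; exact ENNReal.ofReal_le_ofReal hp2
  have hpt : ENNReal.ofReal p ≠ ⊤ := ENNReal.ofReal_ne_top
  set G : Lp ℝ 2 ν :=
    (InnerProductSpace.toDual ℝ (Lp ℝ 2 ν)).symm (ℓ.comp (inclusionL2 ν _ hp2')) with hG
  have hGrep : ∀ f : Lp ℝ 2 ν, ℓ (inclusionL2 ν _ hp2' f) = ∫ x, f x * G x ∂ν := by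
    intro f
    have h := InnerProductSpace.toDual_symm_apply (𝕜 := ℝ) (x := f)
      (y := ℓ.comp (inclusionL2 ν _ hp2'))
    rw [← hG, L2.inner_def] at h
    rw [← ContinuousLinearMap.comp_apply, ← h]
    rfl
  have hrep : ∀ (f : α → ℝ) (hf : MemLp f ⊤ ν),
      ℓ ((hf.mono_exponent le_top).toLp f) = ∫ x, f x * G x ∂ν := by
    intro f hf
    have hf2 : MemLp f 2 ν := hf.mono_exponent le_top
    have h1 : (hf.mono_exponent le_top).toLp f = inclusionL2 ν (ENNReal.ofReal p) hp2'
        (hf2.toLp f) :=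
      MemLp.toLp_congr _ ((Lp.memLp _).mono_exponent hp2') hf2.coeFn_toLp.symm
    rw [h1, hGrep]
    refine integral_congr_ae ?_
    filter_upwards [hf2.coeFn_toLp] with x hx
    rw [hx]
  have hgq : MemLp G (ENNReal.ofReal q) ν := by
    refine memLp_of_forall_integral_mul_le hpq (Lp.memLp G).1 (norm_nonneg ℓ) fun f hf => ?_
    rw [← hrep f hf, ← Real.norm_eq_abs, ← Lp.norm_toLp f (hf.mono_exponent le_top)]
    exact ℓ.le_opNorm _
  refine ⟨G, hgq, ?_⟩
  have : Fact (1 ≤ ENNReal.ofReal q) := ⟨by simpa using hpq.symm.lt.le⟩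
  have : ENNReal.HolderConjugate (ENNReal.ofReal q) (ENNReal.ofReal p) := hpq.symm.ennrealOfReal
  set B : Lp ℝ (ENNReal.ofReal p) ν →L[ℝ] ℝ := (ContinuousLinearMap.mul ℝ ℝ).lpPairing ν
    (ENNReal.ofReal q) (ENNReal.ofReal p) hgq.toLp with hB
  have hBrep : ∀ f : Lp ℝ (ENNReal.ofReal p) ν, B f = ∫ x, f x * G x ∂ν := by
    intro f
    rw [hB, ContinuousLinearMap.lpPairing_eq_integral]
    refine integral_congr_ae ?_
    filter_upwards [hgq.coeFn_toLp] with x hx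
    simp [hx, mul_comm]
  intro f
  rw [← hBrep]
  refine congrFun (Continuous.ext_on (Lp.simpleFunc.dense (E := ℝ) (μ := ν) hpt) ℓ.continuous
    B.continuous ?_) f
  intro s hs
  obtain ⟨t, ht⟩ := (⟨s, hs⟩ : Lp.simpleFunc ℝ (ENNReal.ofReal p) ν).2
  obtain ⟨C, hC⟩ := t.exists_forall_norm_le
  have htop : MemLp t ⊤ ν := memLp_top_of_bound t.aestronglyMeasurable C (.of_forall hC)
  have hst : s = (htop.mono_exponent le_top).toLp t := by
    apply Lp.ext
    refine Filter.EventuallyEq.trans ?_ (MemLp.coeFn_toLp _).symm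
    change (s : α →ₘ[ν] ℝ) =ᵐ[ν] _
    rw [show (s : α →ₘ[ν] ℝ) = _ from ht.symm]
    exact AEEqFun.coeFn_mk _ _
  rw [hst, hrep _ htop, hBrep]
  refine integral_congr_ae ?_
  filter_upwards [MemLp.coeFn_toLp (htop.mono_exponent (le_top : ENNReal.ofReal p ≤ ⊤))] with x hx
  rw [hx]

end Duality

section WeakLp

variable {E : Type*} [NormedAddCommGroup E] [NormedSpace ℝ E] [FiniteDimensional ℝ E]
  [MeasurableSpace E] [BorelSpace E] {μ : Measure E} [IsFiniteMeasureOnCompacts μ]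
  [μ.InnerRegularCompactLTTop]

/-- A bounded sequence in `L^p(Ω)`, `1 < p ≤ 2`, that converges against test functions converges
weakly. -/
theorem tendstoWeakly_Lp_of_forall_test {Ω : Set E} (hΩ : IsOpen Ω) (hΩf : μ Ω ≠ ⊤) {p : ℝ}
    (hp1 : 1 < p) (hp2 : p ≤ 2) [Fact (1 ≤ ENNReal.ofReal p)]
    {s : ℕ → Lp ℝ (ENNReal.ofReal p) (μ.restrict Ω)} {t : Lp ℝ (ENNReal.ofReal p) (μ.restrict Ω)}
    {C : ℝ} (hC : ∀ n, ‖s n‖ ≤ C)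
    (h : ∀ φ : E → ℝ, ContDiff ℝ ∞ φ → HasCompactSupport φ → tsupport φ ⊆ Ω →
      Tendsto (fun n => ∫ x in Ω, s n x * φ x ∂μ) atTop (𝓝 (∫ x in Ω, t x * φ x ∂μ))) :
    TendstoWeakly s t := by
  rw [tendstoWeakly_iff]
  intro ℓ
  have : IsFiniteMeasure (μ.restrict Ω) := ⟨by simpa using hΩf.lt_top⟩
  have hpq := Real.HolderConjugate.conjExponent hp1
  set q := p.conjExponent
  obtain ⟨g, hg, hℓ⟩ := exists_memLp_forall_eq_integral hpq hp2 ℓ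
  have hq1 : 1 ≤ ENNReal.ofReal q := by simpa using hpq.symm.lt.le
  have : Fact (1 ≤ ENNReal.ofReal q) := ⟨hq1⟩
  have : ENNReal.HolderConjugate (ENNReal.ofReal q) (ENNReal.ofReal p) := hpq.symm.ennrealOfReal
  set B := (ContinuousLinearMap.mul ℝ ℝ).lpPairing (μ.restrict Ω)
    (ENNReal.ofReal q) (ENNReal.ofReal p)
  have hB : ∀ (k : E → ℝ) (hk : MemLp k (ENNReal.ofReal q) (μ.restrict Ω))
      (f : Lp ℝ (ENNReal.ofReal p) (μ.restrict Ω)),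
      B hk.toLp f = ∫ x in Ω, f x * k x ∂μ := by
    intro k hk f
    rw [ContinuousLinearMap.lpPairing_eq_integral]
    refine integral_congr_ae ?_
    filter_upwards [hk.coeFn_toLp] with x hx
    simp [hx, mul_comm]
  have happrox : ∀ m : ℕ, ∃ φ : E → ℝ, ContDiff ℝ ∞ φ ∧ HasCompactSupport φ ∧ tsupport φ ⊆ Ω ∧
      eLpNorm (g - φ) (ENNReal.ofReal q) (μ.restrict Ω) ≤ ENNReal.ofReal (1 / ((m : ℝ) + 1)) :=
    fun m => exists_contDiff_tsupport_subset_eLpNorm_sub_le hΩ hΩf hq1 ENNReal.ofReal_ne_top hg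
      Nat.one_div_pos_of_nat
  choose φ hφ hφc hφΩ hφε using happrox
  have hφm : ∀ m, MemLp (φ m) (ENNReal.ofReal q) (μ.restrict Ω) := fun m =>
    (hφ m).continuous.memLp_of_hasCompactSupport (hφc m)
  have hlim : Tendsto (fun m => (hφm m).toLp) atTop (𝓝 hg.toLp) := by
    rw [Lp.tendsto_Lp_iff_tendsto_eLpNorm'']
    have h0 : Tendsto (fun m : ℕ => ENNReal.ofReal (1 / ((m : ℝ) + 1))) atTop (𝓝 0) := by
      simpa using ENNReal.tendsto_ofReal (tendsto_one_div_add_atTop_nhds_zero_nat (𝕜 := ℝ))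
    refine tendsto_of_tendsto_of_tendsto_of_le_of_le tendsto_const_nhds h0 (fun _ => zero_le)
      fun m => ?_
    rw [eLpNorm_sub_comm]
    exact hφε m
  have hBlim : Tendsto (fun m => B (hφm m).toLp) atTop (𝓝 (B hg.toLp)) :=
    (B.continuous.tendsto _).comp hlim
  have hunif : TendstoUniformly (fun m n => B (hφm m).toLp (s n)) (fun n => B hg.toLp (s n))
      atTop := by
    rw [Metric.tendstoUniformly_iff]
    intro ε hε
    have hC' : 0 < |C| + 1 := by positivity
    filter_upwards [(Metric.tendsto_nhds.1 hBlim) (ε / (|C| + 1)) (by positivity)] with m hm n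
    rw [dist_eq_norm] at hm
    rw [dist_comm, dist_eq_norm, ← sub_apply]
    calc _ ≤ ‖B (hφm m).toLp - B hg.toLp‖ * ‖s n‖ := ContinuousLinearMap.le_opNorm _ _
      _ ≤ ‖B (hφm m).toLp - B hg.toLp‖ * (|C| + 1) := by
          gcongr
          linarith [hC n, le_abs_self C]
      _ < ε := (lt_div_iff₀ hC').1 hm
  simp only [hℓ, ← hB g hg]
  refine hunif.tendsto_of_eventually_tendsto (L := fun m => B (hφm m).toLp t)
    (.of_forall fun m => ?_) ?_
  · simp only [hB]
    exact h (φ m) (hφ m) (hφc m) (hφΩ m)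
  · exact ((ContinuousLinearMap.apply ℝ ℝ t).continuous.tendsto _).comp hBlim

end WeakLp

/-! ### The Hessian of a Sobolev function -/

section Hessian

variable {N : ℕ} {Ω : Set (EuclideanSpace ℝ (Fin N))} {p : ℝ≥0∞} [Fact (1 ≤ p)]

/-- Integrating against a test function, both mixed derivatives equal `∫ u ∂ᵢ∂ⱼφ`. -/
theorem SobolevW2.integral_hessian_comm (w : SobolevW2 Ω p) (i j : Fin N)
    {φ : EuclideanSpace ℝ (Fin N) → ℝ} (hφ : ContDiff ℝ ∞ φ) (hc : HasCompactSupport φ)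
    (hs : tsupport φ ⊆ Ω) :
    ∫ x in Ω, w.1.2.2 i j x * φ x = ∫ x in Ω, w.1.2.2 j i x * φ x := by
  have hfd : ∀ j : Fin N, ContDiff ℝ ∞ fun x => fderiv ℝ φ x (EuclideanSpace.single j 1) :=
    fun j => (hφ.fderiv_right (by simp)).clm_apply contDiff_const
  have hfc : ∀ j : Fin N,
      HasCompactSupport fun x => fderiv ℝ φ x (EuclideanSpace.single j 1) :=
    fun j => hc.fderiv_apply (𝕜 := ℝ) _
  have hfs : ∀ j : Fin N,
      tsupport (fun x => fderiv ℝ φ x (EuclideanSpace.single j 1)) ⊆ Ω := fun j =>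
    (tsupport_fderiv_apply_subset ℝ _).trans hs
  have hφ2 : ContDiff ℝ 2 φ := by exact_mod_cast contDiff_infty.1 hφ 2
  have key : ∀ i j : Fin N, ∫ x in Ω, w.1.2.2 i j x * φ x
      = ∫ x in Ω, w.1.1 x * fderiv ℝ (fderiv ℝ φ) x (EuclideanSpace.single i 1)
          (EuclideanSpace.single j 1) := by
    intro i j
    have h1 := w.2.2 i j φ hφ hc hs
    have h2 := w.2.1 i _ (hfd j) (hfc j) (hfs j)
    simp only [(hasFDerivAt_fderiv_apply hφ2 _ _).fderiv, ContinuousLinearMap.flip_apply] at h2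
    linarith
  rw [key, key]
  refine integral_congr_ae (.of_forall fun x => ?_)
  have hsymm := (hφ2.contDiffAt (x := x)).isSymmSndFDerivAt (by simp)
  simp only [hsymm.eq (EuclideanSpace.single i 1) (EuclideanSpace.single j 1)]

/-- Weak second derivatives commute, because those of test functions do. -/
theorem SobolevW2.ae_isSymm_hessian (hΩ : IsOpen Ω) (w : SobolevW2 Ω p) :
    ∀ᵐ x ∂volume.restrict Ω, (SobolevW2.hessian w x).IsSymm := by
  have hae : ∀ i j : Fin N, ∀ᵐ x ∂volume.restrict Ω, w.1.2.2 i j x = w.1.2.2 j i x := by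
    intro i j
    rw [ae_restrict_iff' hΩ.measurableSet]
    have hloc : ∀ i j : Fin N, LocallyIntegrableOn (w.1.2.2 i j) Ω volume := fun i j =>
      locallyIntegrableOn_of_locallyIntegrable_restrict
        ((Lp.memLp (w.1.2.2 i j)).locallyIntegrable Fact.out)
    have h := hΩ.ae_eq_zero_of_integral_contDiff_smul_eq_zero (μ := volume)
      (f := fun x => w.1.2.2 i j x - w.1.2.2 j i x) ((hloc i j).sub (hloc j i)) ?_
    · filter_upwards [h] with x hx hxΩ
      exact sub_eq_zero.1 (hx hxΩ)
    · intro φ hφ hc hs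
      rw [← setIntegral_eq_integral_of_forall_compl_eq_zero (s := Ω)]
      · have h1 := SobolevW2.integral_hessian_comm w i j hφ hc hs
        have h2 : ∀ x, φ x • (w.1.2.2 i j x - w.1.2.2 j i x)
            = w.1.2.2 i j x * φ x - w.1.2.2 j i x * φ x := fun x => by
          rw [smul_eq_mul]; ring
        simp only [h2]
        rw [integral_sub (integrable_Lp_mul_of_hasCompactSupport Ω _ hφ.continuous hc)
          (integrable_Lp_mul_of_hasCompactSupport Ω _ hφ.continuous hc), h1, sub_self]
      · intro x hx
        rw [image_eq_zero_of_notMem_tsupport fun h => hx (hs h), zero_smul]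
  have hall := ae_all_iff.2 fun i => ae_all_iff.2 fun j => hae i j
  filter_upwards [hall] with x hx
  ext i j
  exact hx j i

theorem SobolevW2.kHessian_ae_eq (hΩ : IsOpen Ω) {k : ℕ} (hk : k ≤ N) (w : SobolevW2 Ω p) :
    kHessian k w =ᵐ[volume.restrict Ω] fun x =>
      ∑ s ∈ (Finset.univ : Finset (Fin N)).powersetCard k,
        (Matrix.of fun a b : s => w.1.2.2 a b x).det := by
  filter_upwards [SobolevW2.ae_isSymm_hessian hΩ w] with x hx
  rw [kHessian, eigenSigma_eq_sum_minors hx hk]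
  rfl

theorem SobolevW2.eLpNorm_le (w : SobolevW2 Ω p) :
    (∀ i, eLpNorm (w.1.2.1 i) p (volume.restrict Ω) ≤ ENNReal.ofReal ‖w‖) ∧
      ∀ i j, eLpNorm (w.1.2.2 i j) p (volume.restrict Ω) ≤ ENNReal.ofReal ‖w‖ := by
  have h : ∀ f : Lp ℝ p (volume.restrict Ω), ‖f‖ ≤ ‖w‖ →
      eLpNorm f p (volume.restrict Ω) ≤ ENNReal.ofReal ‖w‖ := by
    intro f hf
    rw [← Lp.enorm_def, ← ofReal_norm]
    exact ENNReal.ofReal_le_ofReal hf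
  have h1 : ‖w.1.2.1‖ ≤ ‖w‖ := (norm_fst_le w.1.2).trans (norm_snd_le w.1)
  have h2 : ‖w.1.2.2‖ ≤ ‖w‖ := (norm_snd_le w.1.2).trans (norm_snd_le w.1)
  exact ⟨fun i => h _ ((norm_le_pi_norm w.1.2.1 i).trans h1),
    fun i j => h _ (((norm_le_pi_norm (w.1.2.2 i) j).trans (norm_le_pi_norm w.1.2.2 i)).trans h2)⟩

end Hessian

section KHessianBound

variable {N k : ℕ} {Ω : Set (EuclideanSpace ℝ (Fin N))} {p : ℝ≥0∞} [Fact (1 ≤ (k : ℝ≥0∞) * p)]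

theorem memLp_minor (hk : 1 ≤ k) (hp1 : 1 ≤ p) (hp : p ≠ ⊤)
    (w : SobolevW2 Ω ((k : ℝ≥0∞) * p)) {s : Finset (Fin N)} (hs : s.card = k) :
    MemLp (fun x => (Matrix.of fun a b : s => w.1.2.2 a b x).det) p (volume.restrict Ω) := by
  have : Nonempty s := by
    rw [Finset.nonempty_coe_sort, ← Finset.card_pos]; omega
  have hc : Fintype.card s = k := by rw [Fintype.card_coe, hs]
  have h := memLp_det (μ := volume.restrict Ω) hp1 hp
    (g := fun a b : s => (w.1.2.2 a b : EuclideanSpace ℝ (Fin N) → ℝ))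
    fun a b => by rw [hc]; exact Lp.memLp _
  convert h

theorem memLp_kHessian (hΩ : IsOpen Ω) (hk : 1 ≤ k) (hkN : k ≤ N) (hp1 : 1 ≤ p) (hp : p ≠ ⊤)
    (w : SobolevW2 Ω ((k : ℝ≥0∞) * p)) : MemLp (kHessian k w) p (volume.restrict Ω) := by
  refine MemLp.ae_eq (SobolevW2.kHessian_ae_eq hΩ hkN w).symm ?_
  exact memLp_finsetSum _ fun s hs => memLp_minor hk hp1 hp w (Finset.mem_powersetCard.1 hs).2

theorem eLpNorm_minor_le (hk : 1 ≤ k) (hp1 : 1 ≤ p) (hp : p ≠ ⊤)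
    (w : SobolevW2 Ω ((k : ℝ≥0∞) * p)) {s : Finset (Fin N)} (hs : s.card = k) :
    eLpNorm (fun x => (Matrix.of fun a b : s => w.1.2.2 a b x).det) p (volume.restrict Ω)
      ≤ k.factorial * ENNReal.ofReal ‖w‖ ^ k := by
  have : Nonempty s := by
    rw [Finset.nonempty_coe_sort, ← Finset.card_pos]; omega
  have hc : Fintype.card s = k := by rw [Fintype.card_coe, hs]
  have h := eLpNorm_det_le (μ := volume.restrict Ω) (p := p)
    (h := fun a b : s => (w.1.2.2 a b : EuclideanSpace ℝ (Fin N) → ℝ))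
    (fun a b => (Lp.memLp _).1) hp1 hp (m := fun _ => ENNReal.ofReal ‖w‖)
    (fun a b => by rw [hc]; exact (SobolevW2.eLpNorm_le w).2 a b)
  rw [Finset.prod_const, Finset.card_univ, hc] at h
  convert h

theorem eLpNorm_fun_sum_le_card_mul {α κ : Type*} [MeasurableSpace α] {μ : Measure α}
    {S : Finset κ} {D : κ → α → ℝ} (hp1 : 1 ≤ p) (hm : ∀ s ∈ S, AEStronglyMeasurable (D s) μ)
    {B : ℝ≥0∞} (hB : ∀ s ∈ S, eLpNorm (D s) p μ ≤ B) :
    eLpNorm (fun x => ∑ s ∈ S, D s x) p μ ≤ S.card * B := by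
  have hsum : (fun x => ∑ s ∈ S, D s x) = ∑ s ∈ S, D s :=
    funext fun x => (Finset.sum_apply x _ D).symm
  rw [hsum]
  refine ((eLpNorm_sum_le hm hp1).trans (Finset.sum_le_sum hB)).trans (le_of_eq ?_)
  simp

theorem eLpNorm_kHessian_le (hΩ : IsOpen Ω) (hk : 1 ≤ k) (hkN : k ≤ N) (hp1 : 1 ≤ p) (hp : p ≠ ⊤)
    (w : SobolevW2 Ω ((k : ℝ≥0∞) * p)) :
    eLpNorm (kHessian k w) p (volume.restrict Ω)
      ≤ (N.choose k) * (k.factorial * ENNReal.ofReal ‖w‖ ^ k) := by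
  have hcard : (N.choose k : ℝ≥0∞)
      = ((Finset.univ : Finset (Fin N)).powersetCard k).card := by simp
  rw [eLpNorm_congr_ae (SobolevW2.kHessian_ae_eq hΩ hkN w), hcard]
  exact eLpNorm_fun_sum_le_card_mul hp1
    (fun s hs => (memLp_minor hk hp1 hp w (Finset.mem_powersetCard.1 hs).2).1)
    fun s hs => eLpNorm_minor_le hk hp1 hp w (Finset.mem_powersetCard.1 hs).2

end KHessianBound

/-! ### Localization -/

section Localization

variable {N : ℕ} {Ω : Set (EuclideanSpace ℝ (Fin N))} {p : ℝ≥0∞} [Fact (1 ≤ p)]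

/-- Leibniz' rule: multiplied by a cutoff supported in `Ω`, a function that is weakly
differentiable in `Ω` is weakly differentiable on the whole space. -/
theorem IsWeakPartial.cutoff_mul {j : Fin N} {f g : Lp ℝ p (volume.restrict Ω)}
    (h : IsWeakPartial Ω j f g) {χ : EuclideanSpace ℝ (Fin N) → ℝ} (hχ : ContDiff ℝ ∞ χ)
    (hχc : HasCompactSupport χ) (hχΩ : tsupport χ ⊆ Ω) :
    IsWeakPartial Set.univ j (fun x => χ x * f x)
      (fun x => χ x * g x + fderiv ℝ χ x (EuclideanSpace.single j 1) * f x) := by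
  intro ψ hψ hψc _
  beta_reduce
  have hχ0 : ∀ x, x ∉ Ω → χ x = 0 := fun x hx =>
    image_eq_zero_of_notMem_tsupport fun h => hx (hχΩ h)
  have hdχ0 : ∀ x, x ∉ Ω → fderiv ℝ χ x (EuclideanSpace.single j 1) = 0 := fun x hx => by
    rw [fderiv_of_notMem_tsupport ℝ fun h => hx (hχΩ h)]; rfl
  have hdχc : Continuous fun x => fderiv ℝ χ x (EuclideanSpace.single j 1) :=
    (hχ.continuous_fderiv (by simp)).clm_apply continuous_const
  have z1 : ∫ x in Ω, χ x * f x * fderiv ℝ ψ x (EuclideanSpace.single j 1)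
      = ∫ x, χ x * f x * fderiv ℝ ψ x (EuclideanSpace.single j 1) :=
    setIntegral_eq_integral_of_forall_compl_eq_zero fun x hx => by rw [hχ0 x hx]; ring
  have z2 : ∫ x in Ω, (χ x * g x + fderiv ℝ χ x (EuclideanSpace.single j 1) * f x) * ψ x
      = ∫ x, (χ x * g x + fderiv ℝ χ x (EuclideanSpace.single j 1) * f x) * ψ x :=
    setIntegral_eq_integral_of_forall_compl_eq_zero fun x hx => by
      rw [hχ0 x hx, hdχ0 x hx]; ring
  have h1 := h (fun x => χ x * ψ x) (hχ.mul hψ) hχc.mul_right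
    ((tsupport_mul_subset_left).trans hχΩ)
  have hder : ∀ x, fderiv ℝ (fun x => χ x * ψ x) x (EuclideanSpace.single j 1)
      = χ x * fderiv ℝ ψ x (EuclideanSpace.single j 1)
        + ψ x * fderiv ℝ χ x (EuclideanSpace.single j 1) := by
    intro x
    rw [fderiv_fun_mul (hχ.differentiable (by simp) x) (hψ.differentiable (by simp) x)]
    simp
  have hi1 := integrable_Lp_mul_of_hasCompactSupport Ω f
    (φ := fun x => χ x * fderiv ℝ ψ x (EuclideanSpace.single j 1))
    (hχ.continuous.mul ((hψ.continuous_fderiv (by simp)).clm_apply continuous_const)) hχc.mul_right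
  have hi2 := integrable_Lp_mul_of_hasCompactSupport Ω f
    (φ := fun x => ψ x * fderiv ℝ χ x (EuclideanSpace.single j 1))
    (hψ.continuous.mul hdχc) hψc.mul_right
  have hi3 := integrable_Lp_mul_of_hasCompactSupport Ω g
    (φ := fun x => χ x * ψ x) (hχ.continuous.mul hψ.continuous) hχc.mul_right
  simp only [hder, mul_add] at h1
  rw [integral_add hi1 hi2] at h1
  have e1 : ∫ x in Ω, χ x * f x * fderiv ℝ ψ x (EuclideanSpace.single j 1)
      = ∫ x in Ω, f x * (χ x * fderiv ℝ ψ x (EuclideanSpace.single j 1)) :=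
    integral_congr_ae (.of_forall fun x => by ring)
  have e2 : ∫ x in Ω, (χ x * g x + fderiv ℝ χ x (EuclideanSpace.single j 1) * f x) * ψ x
      = ∫ x in Ω, (g x * (χ x * ψ x)
        + f x * (ψ x * fderiv ℝ χ x (EuclideanSpace.single j 1))) :=
    integral_congr_ae (.of_forall fun x => by ring)
  rw [Measure.restrict_univ, ← z1, ← z2, e1, e2, integral_add hi3 hi2]
  linarith

/-- Integration of `T u` against a compactly supported continuous function is a continuous linear
functional of `u`. -/
theorem tendsto_integral_mul_of_tendstoWeakly {X : Type*} [NormedAddCommGroup X] [NormedSpace ℝ X]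
    {u : ℕ → X} {v : X} (h : TendstoWeakly u v) (T : X →L[ℝ] Lp ℝ p (volume.restrict Ω))
    {θ : EuclideanSpace ℝ (Fin N) → ℝ} (hθ : Continuous θ) (hθc : HasCompactSupport θ) :
    Tendsto (fun n => ∫ x in Ω, T (u n) x * θ x) atTop (𝓝 (∫ x in Ω, T v x * θ x)) := by
  have hpq : ENNReal.HolderConjugate p.conjExponent p :=
    (ENNReal.HolderConjugate.conjExponent Fact.out).symm
  have : Fact (1 ≤ p.conjExponent) := ⟨hpq.one_le⟩
  have hθm : MemLp θ p.conjExponent (volume.restrict Ω) := hθ.memLp_of_hasCompactSupport hθc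
  have hB : ∀ f : Lp ℝ p (volume.restrict Ω), (ContinuousLinearMap.mul ℝ ℝ).lpPairing
      (volume.restrict Ω) p.conjExponent p hθm.toLp f = ∫ x in Ω, f x * θ x := by
    intro f
    rw [ContinuousLinearMap.lpPairing_eq_integral]
    refine integral_congr_ae ?_
    filter_upwards [hθm.coeFn_toLp] with x hx
    simp [hx, mul_comm]
  simp only [← hB]
  exact tendstoWeakly_iff.1 h (((ContinuousLinearMap.mul ℝ ℝ).lpPairing
      (volume.restrict Ω) p.conjExponent p hθm.toLp).comp T)

end Localization

section Cutoff

variable {N : ℕ} {Ω : Set (EuclideanSpace ℝ (Fin N))} {p : ℝ≥0∞}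

/-- A cutoff supported in a set of finite measure lowers the exponent of integrability to any
`r ≤ p`. -/
theorem eLpNorm_cutoff_mul_le {r : ℝ≥0∞} (hrp : r ≤ p) {χ : EuclideanSpace ℝ (Fin N) → ℝ}
    (hχΩ : ∀ x, x ∉ Ω → χ x = 0) {C : ℝ} (hC : ∀ x, ‖χ x‖ ≤ C) (f : Lp ℝ p (volume.restrict Ω))
    {A : ℝ≥0∞} (hA : eLpNorm f p (volume.restrict Ω) ≤ A) :
    eLpNorm (fun x => χ x * f x) r volume ≤ ENNReal.ofReal C *
      (A * volume Ω ^ (1 / r.toReal - 1 / p.toReal)) := by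
  have hsupp : Function.support (fun x => χ x * f x) ⊆ Ω := by
    intro x hx
    by_contra hxΩ
    exact hx (by simp [hχΩ x hxΩ])
  rw [← eLpNorm_restrict_eq_of_support_subset hsupp]
  refine (eLpNorm_le_mul_eLpNorm_of_ae_le_mul'' (c := ENNReal.ofReal C) _ (Lp.memLp f).1
    (.of_forall fun x => ?_)).trans (mul_le_mul_right ?_ _)
  · rw [enorm_mul, ← ofReal_norm (χ x)]
    gcongr
    exact hC x
  · refine (eLpNorm_le_eLpNorm_mul_rpow_measure_univ hrp (Lp.memLp f).1).trans ?_
    rw [Measure.restrict_apply_univ]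
    gcongr

theorem aestronglyMeasurable_cutoff_mul (hΩ : MeasurableSet Ω)
    {χ : EuclideanSpace ℝ (Fin N) → ℝ} (hχ : Continuous χ) (hχΩ : ∀ x, x ∉ Ω → χ x = 0)
    (f : Lp ℝ p (volume.restrict Ω)) :
    AEStronglyMeasurable (fun x => χ x * f x) volume := by
  have h : AEStronglyMeasurable (fun x => χ x * f x) (volume.restrict Ω) :=
    hχ.aestronglyMeasurable.mul (Lp.memLp f).1
  have h2 := (aestronglyMeasurable_indicator_iff hΩ).2 h
  rwa [Set.indicator_eq_self.2] at h2
  intro x hx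
  by_contra hxΩ
  exact hx (by simp [hχΩ x hxΩ])

end Cutoff

section MinorsOnDomain

variable {N : ℕ} {Ω : Set (EuclideanSpace ℝ (Fin N))} {p : ℝ≥0∞} [Fact (1 ≤ p)]

/-- The first-order coordinate `u ↦ ∂ₐu` as a continuous linear map. -/
noncomputable def SobolevW2.gradCoord (a : Fin N) :
    SobolevW2 Ω p →L[ℝ] Lp ℝ p (volume.restrict Ω) :=
  (ContinuousLinearMap.proj a).comp ((ContinuousLinearMap.fst ℝ _ _).comp
    ((ContinuousLinearMap.snd ℝ _ _).comp (SobolevW2 Ω p).subtypeL))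

/-- The second-order coordinate `u ↦ ∂ⱼ∂ₐu` as a continuous linear map. -/
noncomputable def SobolevW2.hessCoord (a j : Fin N) :
    SobolevW2 Ω p →L[ℝ] Lp ℝ p (volume.restrict Ω) :=
  (ContinuousLinearMap.proj j).comp ((ContinuousLinearMap.proj a).comp
    ((ContinuousLinearMap.snd ℝ _ _).comp
      ((ContinuousLinearMap.snd ℝ _ _).comp (SobolevW2 Ω p).subtypeL)))

/-- The `j`-th component of the weak gradient of the localized derivative `χ ∂ₐu`, as given by
Leibniz' rule. -/
noncomputable def SobolevW2.cutoffGrad (χ : EuclideanSpace ℝ (Fin N) → ℝ)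
    (w : SobolevW2 Ω p) (a j : Fin N) (x : EuclideanSpace ℝ (Fin N)) : ℝ :=
  χ x * w.1.2.2 a j x + fderiv ℝ χ x (EuclideanSpace.single j 1) * w.1.2.1 a x

section CutoffGrad

variable {χ : EuclideanSpace ℝ (Fin N) → ℝ}

theorem continuous_fderiv_single (hχ : ContDiff ℝ ∞ χ) (j : Fin N) :
    Continuous fun x => fderiv ℝ χ x (EuclideanSpace.single j 1) :=
  (hχ.continuous_fderiv (by simp)).clm_apply continuous_const

theorem fderiv_single_eq_zero_of_notMem (hχΩ : tsupport χ ⊆ Ω) (j : Fin N)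
    {x : EuclideanSpace ℝ (Fin N)} (hx : x ∉ Ω) :
    fderiv ℝ χ x (EuclideanSpace.single j 1) = 0 := by
  rw [fderiv_of_notMem_tsupport ℝ fun h => hx (hχΩ h)]; rfl

theorem eq_zero_of_notMem_of_tsupport_subset (hχΩ : tsupport χ ⊆ Ω)
    {x : EuclideanSpace ℝ (Fin N)} (hx : x ∉ Ω) : χ x = 0 :=
  image_eq_zero_of_notMem_tsupport fun h => hx (hχΩ h)

theorem SobolevW2.aestronglyMeasurable_cutoffGrad (hΩ : MeasurableSet Ω) (hχ : ContDiff ℝ ∞ χ)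
    (hχΩ : tsupport χ ⊆ Ω) (w : SobolevW2 Ω p) (a j : Fin N) :
    AEStronglyMeasurable (SobolevW2.cutoffGrad χ w a j) volume :=
  (aestronglyMeasurable_cutoff_mul hΩ hχ.continuous
    (fun _ => eq_zero_of_notMem_of_tsupport_subset hχΩ) _).add
  (aestronglyMeasurable_cutoff_mul hΩ (continuous_fderiv_single hχ j)
    (fun _ => fderiv_single_eq_zero_of_notMem hχΩ j) _)

/-- On a set of finite measure the localized gradients are bounded in every `L^r`, `r ≤ p`, by the
`W^{2,p}` norm. -/
theorem SobolevW2.exists_eLpNorm_cutoffGrad_le (hΩ : MeasurableSet Ω) (hΩf : volume Ω ≠ ⊤)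
    (hχ : ContDiff ℝ ∞ χ) (hχc : HasCompactSupport χ) (hχΩ : tsupport χ ⊆ Ω) {r : ℝ≥0∞}
    (hr1 : 1 ≤ r) (hrtop : r ≠ ⊤) (hrp : r ≤ p) (B : ℝ) :
    ∃ M : ℝ≥0∞, M ≠ ⊤ ∧ ∀ w : SobolevW2 Ω p, ‖w‖ ≤ B →
      (∀ a, eLpNorm (fun x => χ x * w.1.2.1 a x) r volume ≤ M) ∧
        ∀ a j, eLpNorm (SobolevW2.cutoffGrad χ w a j) r volume ≤ M := by
  obtain ⟨C, hC⟩ := hχc.exists_bound_of_continuous hχ.continuous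
  obtain ⟨D, hD⟩ := (hχc.fderiv (𝕜 := ℝ)).exists_bound_of_continuous
    (hχ.continuous_fderiv (by simp))
  have hD' : ∀ (j : Fin N) x, ‖fderiv ℝ χ x (EuclideanSpace.single j 1)‖ ≤ D := fun j x =>
    (ContinuousLinearMap.le_opNorm _ _).trans (by simpa using hD x)
  have h0 : ∀ x, x ∉ Ω → χ x = 0 := fun _ => eq_zero_of_notMem_of_tsupport_subset hχΩ
  have hd0 : ∀ j : Fin N, ∀ x, x ∉ Ω → fderiv ℝ χ x (EuclideanSpace.single j 1) = 0 :=
    fun j _ => fderiv_single_eq_zero_of_notMem hχΩ j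
  set Q : ℝ≥0∞ := volume Ω ^ (1 / r.toReal - 1 / p.toReal) with hQdef
  have hQ : Q ≠ ⊤ := by
    refine ENNReal.rpow_ne_top_of_nonneg ?_ hΩf
    rw [sub_nonneg]
    by_cases hp : p = ⊤
    · simp [hp]
    · exact one_div_le_one_div_of_le
        (ENNReal.toReal_pos (zero_lt_one.trans_le hr1).ne' hrtop) (ENNReal.toReal_mono hp hrp)
  refine ⟨ENNReal.ofReal C * (ENNReal.ofReal B * Q) + ENNReal.ofReal D * (ENNReal.ofReal B * Q),
    by finiteness, fun w hw => ?_⟩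
  have hw' := ENNReal.ofReal_le_ofReal hw
  obtain ⟨hw1, hw2⟩ := SobolevW2.eLpNorm_le w
  refine ⟨fun a => (eLpNorm_cutoff_mul_le hrp h0 hC _ ((hw1 a).trans hw')).trans le_self_add,
    fun a j => ?_⟩
  exact (eLpNorm_add_le
    (aestronglyMeasurable_cutoff_mul hΩ hχ.continuous h0 _)
    (aestronglyMeasurable_cutoff_mul hΩ (continuous_fderiv_single hχ j) (hd0 j) _) hr1).trans
    (add_le_add (eLpNorm_cutoff_mul_le hrp h0 hC _ ((hw2 a j).trans hw'))
      (eLpNorm_cutoff_mul_le hrp (hd0 j) (hD' j) _ ((hw1 a).trans hw')))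

theorem SobolevW2.integral_cutoffGrad_mul (hχ : ContDiff ℝ ∞ χ) (hχc : HasCompactSupport χ)
    (hχΩ : tsupport χ ⊆ Ω) (w : SobolevW2 Ω p) (a j : Fin N)
    {ψ : EuclideanSpace ℝ (Fin N) → ℝ} (hψ : ContDiff ℝ ∞ ψ) (hψc : HasCompactSupport ψ) :
    ∫ x, SobolevW2.cutoffGrad χ w a j x * ψ x
      = (∫ x in Ω, SobolevW2.hessCoord a j w x * (χ x * ψ x))
        + ∫ x in Ω, SobolevW2.gradCoord a w x
          * (fderiv ℝ χ x (EuclideanSpace.single j 1) * ψ x) := by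
  have h1 := integrable_Lp_mul_of_hasCompactSupport Ω (SobolevW2.hessCoord a j w)
    (φ := fun x => χ x * ψ x) (hχ.continuous.mul hψ.continuous) hχc.mul_right
  have h2 := integrable_Lp_mul_of_hasCompactSupport Ω (SobolevW2.gradCoord a w)
    (φ := fun x => fderiv ℝ χ x (EuclideanSpace.single j 1) * ψ x)
    ((continuous_fderiv_single hχ j).mul hψ.continuous) hψc.mul_left
  rw [← integral_add h1 h2, ← setIntegral_eq_integral_of_forall_compl_eq_zero (s := Ω)
    (fun x hx => by
      rw [SobolevW2.cutoffGrad, eq_zero_of_notMem_of_tsupport_subset hχΩ hx,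
        fderiv_single_eq_zero_of_notMem hχΩ j hx]
      ring)]
  refine integral_congr_ae (.of_forall fun x => ?_)
  change (χ x * w.1.2.2 a j x + fderiv ℝ χ x (EuclideanSpace.single j 1) * w.1.2.1 a x) * ψ x
    = w.1.2.2 a j x * (χ x * ψ x)
      + w.1.2.1 a x * (fderiv ℝ χ x (EuclideanSpace.single j 1) * ψ x)
  ring

theorem SobolevW2.tendsto_integral_cutoffGrad_mul (hχ : ContDiff ℝ ∞ χ)
    (hχc : HasCompactSupport χ) (hχΩ : tsupport χ ⊆ Ω) {u : ℕ → SobolevW2 Ω p}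
    {v : SobolevW2 Ω p} (huv : TendstoWeakly u v) (a j : Fin N)
    {ψ : EuclideanSpace ℝ (Fin N) → ℝ} (hψ : ContDiff ℝ ∞ ψ) (hψc : HasCompactSupport ψ) :
    Tendsto (fun n => ∫ x, SobolevW2.cutoffGrad χ (u n) a j x * ψ x) atTop
      (𝓝 (∫ x, SobolevW2.cutoffGrad χ v a j x * ψ x)) := by
  simp only [SobolevW2.integral_cutoffGrad_mul hχ hχc hχΩ _ a j hψ hψc]
  have h1 := tendsto_integral_mul_of_tendstoWeakly huv (SobolevW2.hessCoord a j)
    (θ := fun x => χ x * ψ x) (hχ.continuous.mul hψ.continuous) hχc.mul_right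
  have h2 := tendsto_integral_mul_of_tendstoWeakly huv (SobolevW2.gradCoord a)
    (θ := fun x => fderiv ℝ χ x (EuclideanSpace.single j 1) * ψ x)
    ((continuous_fderiv_single hχ j).mul hψ.continuous) hψc.mul_left
  exact h1.add h2

/-- Where `φ` lives the cutoff is locally constant one, so localization does not affect minors
tested against `φ`. -/
theorem SobolevW2.integral_mul_det_cutoffGrad (s : Finset (Fin N)) (w : SobolevW2 Ω p)
    {φ : EuclideanSpace ℝ (Fin N) → ℝ} (hφΩ : tsupport φ ⊆ Ω)
    (hχ1 : ∀ x ∈ tsupport φ, χ =ᶠ[𝓝 x] 1) :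
    ∫ x, φ x * (Matrix.of fun a c : s => SobolevW2.cutoffGrad χ w a c x).det
      = ∫ x in Ω, φ x * (Matrix.of fun a b : s => w.1.2.2 a b x).det := by
  rw [← setIntegral_eq_integral_of_forall_compl_eq_zero (s := Ω) (fun x hx => by
    rw [eq_zero_of_notMem_of_tsupport_subset hφΩ hx, zero_mul])]
  refine integral_congr_ae (.of_forall fun x => ?_)
  by_cases hx : x ∈ tsupport φ
  · have h1 : χ x = 1 := (hχ1 x hx).self_of_nhds
    have h2 : fderiv ℝ χ x = 0 := by
      rw [(hχ1 x hx).fderiv_eq]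
      exact fderiv_const_apply (1 : ℝ)
    simp only [SobolevW2.cutoffGrad, h1, h2, one_mul, zero_mul, add_zero,
      zero_apply]
  · simp only [image_eq_zero_of_notMem_tsupport hx, zero_mul]

end CutoffGrad

/-- Weak `W^{2,p}` convergence, `p ≥ |s|`, passes to the principal `s`-minor of the Hessian in the
sense of distributions: after localization by a cutoff `χ`, the rows of the minor are gradients of
the functions `χ ∂ₐu` on the whole space. -/
theorem SobolevW2.tendsto_integral_minor (hΩ : IsOpen Ω) (hΩf : volume Ω ≠ ⊤)
    {s : Finset (Fin N)} (hs : s.Nonempty) (hsp : (s.card : ℝ≥0∞) ≤ p)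
    {u : ℕ → SobolevW2 Ω p} {v : SobolevW2 Ω p} (huv : TendstoWeakly u v)
    {φ : EuclideanSpace ℝ (Fin N) → ℝ} (hφ : ContDiff ℝ ∞ φ) (hc : HasCompactSupport φ)
    (hφΩ : tsupport φ ⊆ Ω) :
    Tendsto (fun n => ∫ x in Ω, φ x * (Matrix.of fun a b : s => (u n).1.2.2 a b x).det) atTop
      (𝓝 (∫ x in Ω, φ x * (Matrix.of fun a b : s => v.1.2.2 a b x).det)) := by
  have : Nonempty s := hs.coe_sort
  obtain ⟨χ, hχ, hχc, hχΩ, hχ1, -⟩ := exists_contDiff_cutoff hc hΩ hφΩ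
  obtain ⟨B, hB⟩ := huv.exists_norm_le
  obtain ⟨M, hM, hMb⟩ := SobolevW2.exists_eLpNorm_cutoffGrad_le hΩ.measurableSet hΩf hχ hχc hχΩ
    (r := Fintype.card s) (p := p) one_le_natCast_card (ENNReal.natCast_ne_top _)
    (by rwa [Fintype.card_coe]) (max B ‖v‖)
  have hu := fun n => hMb (u n) ((hB n).trans (le_max_left _ _))
  have hv := hMb v (le_max_right _ _)
  have key := _root_.tendsto_integral_minor (ι := s) (Subtype.val : s → Fin N)
    (f := fun n a x => χ x * (u n).1.2.1 a x)
    (g := fun n a => SobolevW2.cutoffGrad χ (u n) a) (g' := fun a => SobolevW2.cutoffGrad χ v a) hM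
    (fun n a => ⟨aestronglyMeasurable_cutoff_mul hΩ.measurableSet hχ.continuous
      (fun _ => eq_zero_of_notMem_of_tsupport_subset hχΩ) _,
      ((hu n).1 a).trans_lt hM.lt_top⟩)
    (fun n a => SobolevW2.aestronglyMeasurable_cutoffGrad hΩ.measurableSet hχ hχΩ (u n) a)
    (fun n a => (hu n).2 a)
    (fun a => SobolevW2.aestronglyMeasurable_cutoffGrad hΩ.measurableSet hχ hχΩ v a)
    (fun a => hv.2 a)
    (fun n a j => ((u n).2.2 a j).cutoff_mul hχ hχc hχΩ)
    (fun a j _ => SobolevW2.tendsto_integral_cutoffGrad_mul hχ hχc hχΩ huv a j)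
    (hφ.of_le (by simp)) hc
  simp only [← SobolevW2.integral_mul_det_cutoffGrad s _ hφΩ hχ1]
  convert key

end MinorsOnDomain

/-! ### Weak continuity of the `k`-Hessian -/

/-- `S_k` is a sum of principal minors, so weak convergence passes to it in the sense of
distributions. -/
theorem tendsto_integral_kHessian_mul {N k : ℕ} {Ω : Set (EuclideanSpace ℝ (Fin N))} {p : ℝ≥0∞}
    [Fact (1 ≤ (k : ℝ≥0∞) * p)] (hΩ : IsOpen Ω) (hΩf : volume Ω ≠ ⊤) (hk : 1 ≤ k) (hkN : k ≤ N)
    (hp1 : 1 ≤ p) (hp : p ≠ ⊤) {u : ℕ → SobolevW2 Ω ((k : ℝ≥0∞) * p)}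
    {v : SobolevW2 Ω ((k : ℝ≥0∞) * p)} (huv : TendstoWeakly u v)
    {φ : EuclideanSpace ℝ (Fin N) → ℝ} (hφ : ContDiff ℝ ∞ φ) (hc : HasCompactSupport φ)
    (hφΩ : tsupport φ ⊆ Ω) :
    Tendsto (fun n => ∫ x in Ω, kHessian k (u n) x * φ x) atTop
      (𝓝 (∫ x in Ω, kHessian k v x * φ x)) := by
  have hsum : ∀ w : SobolevW2 Ω ((k : ℝ≥0∞) * p), ∫ x in Ω, kHessian k w x * φ x
      = ∑ s ∈ (Finset.univ : Finset (Fin N)).powersetCard k,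
        ∫ x in Ω, φ x * (Matrix.of fun a b : s => w.1.2.2 a b x).det := by
    intro w
    rw [← integral_finsetSum]
    · refine integral_congr_ae ?_
      filter_upwards [SobolevW2.kHessian_ae_eq hΩ hkN w] with x hx
      rw [hx, mul_comm, Finset.mul_sum]
    · intro s hs
      have hm := (memLp_minor hk hp1 hp w (Finset.mem_powersetCard.1 hs).2).locallyIntegrable hp1
      exact hm.integrable_smul_left_of_hasCompactSupport hφ.continuous hc
  simp only [hsum]
  refine tendsto_finsetSum _ fun s hs => ?_
  have hs := (Finset.mem_powersetCard.1 hs).2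
  refine SobolevW2.tendsto_integral_minor hΩ hΩf (Finset.card_pos.1 (by omega)) ?_ huv hφ hc hφΩ
  rw [hs]
  exact le_mul_of_one_le_right' hp1

theorem mainTheorem11 (N k : ℕ) (hk : 2 ≤ k) (hkN : 2 * k < N)
    (Ω : Set (EuclideanSpace ℝ (Fin N))) (hΩ : IsOpen Ω) (hΩb : Bornology.IsBounded Ω) :
    haveI : Fact (1 ≤ pStar N k) := ⟨one_le_pStar hk hkN⟩
    haveI : Fact (1 ≤ (k : ℝ≥0∞) * pStar N k) := ⟨one_le_mul_pStar hk hkN⟩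
    ∃ hS : ∀ w : SobolevW2 Ω ((k : ℝ≥0∞) * pStar N k),
        MemLp (kHessian k w) (pStar N k) (volume.restrict Ω),
      ∀ (u : ℕ → SobolevW2 Ω ((k : ℝ≥0∞) * pStar N k))
        (v : SobolevW2 Ω ((k : ℝ≥0∞) * pStar N k)),
        TendstoWeakly u v →
          TendstoWeakly (fun n => (hS (u n)).toLp (kHessian k (u n)))
            ((hS v).toLp (kHessian k v)) := by
  have hp1 := one_le_pStar hk hkN
  have : Fact (1 ≤ pStar N k) := ⟨hp1⟩
  have : Fact (1 ≤ (k : ℝ≥0∞) * pStar N k) := ⟨one_le_mul_pStar hk hkN⟩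
  have hp : pStar N k ≠ ⊤ := ENNReal.ofReal_ne_top
  have hk1 : 1 ≤ k := by omega
  have hkN' : k ≤ N := by omega
  have hΩf : volume Ω ≠ ⊤ := hΩb.measure_lt_top.ne
  refine ⟨memLp_kHessian hΩ hk1 hkN' hp1 hp, fun u v huv => ?_⟩
  obtain ⟨B, hB⟩ := huv.exists_norm_le
  have hkR : (2 : ℝ) ≤ k := by exact_mod_cast hk
  have hkNR : 2 * (k : ℝ) < N := by exact_mod_cast hkN
  -- The strict inequality `1 < p*` is equivalent to `2 k < N`.
  have hr1 : 1 < ((N : ℝ) * ((k : ℝ) + 1)) / ((k : ℝ) * ((N : ℝ) + 2)) := by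
    rw [one_lt_div (by positivity)]; nlinarith
  have hr2 : ((N : ℝ) * ((k : ℝ) + 1)) / ((k : ℝ) * ((N : ℝ) + 2)) ≤ 2 := by
    rw [div_le_iff₀ (by positivity)]; nlinarith
  have : Fact (1 ≤ ENNReal.ofReal (((N : ℝ) * ((k : ℝ) + 1)) / ((k : ℝ) * ((N : ℝ) + 2)))) :=
    ⟨hp1⟩
  refine tendstoWeakly_Lp_of_forall_test hΩ hΩf hr1 hr2
    (C := N.choose k * (k.factorial * max B 0 ^ k)) (fun n => ?_) fun φ hφ hc hφΩ => ?_
  · refine (Lp.norm_toLp _ _).trans_le (ENNReal.toReal_le_of_le_ofReal (by positivity) ?_)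
    refine (eLpNorm_kHessian_le hΩ hk1 hkN' hp1 hp (u n)).trans ?_
    rw [ENNReal.ofReal_mul (by positivity), ENNReal.ofReal_mul (by positivity),
      ENNReal.ofReal_natCast, ENNReal.ofReal_natCast, ENNReal.ofReal_pow (le_max_right _ _)]
    gcongr
    exact (hB n).trans (le_max_left _ _)
  · have hcoe : ∀ w : SobolevW2 Ω ((k : ℝ≥0∞) * pStar N k),
        ∫ x in Ω, (memLp_kHessian hΩ hk1 hkN' hp1 hp w).toLp (kHessian k w) x * φ x
          = ∫ x in Ω, kHessian k w x * φ x := fun w => by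
      refine integral_congr_ae ?_
      filter_upwards [(memLp_kHessian hΩ hk1 hkN' hp1 hp w).coeFn_toLp] with x hx
      rw [hx]
    have key := tendsto_integral_kHessian_mul hΩ hΩf hk1 hkN' hp1 hp huv hφ hc hφΩ
    simp only [← hcoe] at key
    exact key
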